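/- Let $1\le k\le n$ be integers, let $p\ge k+1$ be real, and let $\varphi$ be a positive smooth function on the unit sphere $\mathbb{S}^n\subset\mathbb{R}^{n+1}$. Let $\bar g,\bar\nabla$ be the round metric and its Levi-Civita connection. For a smooth function $h$ on $\mathbb{S}^n$ let $\sigma_k$ be the $k$th elementary symmetric polynomial, normalized by $\sigma_k(1,\dots,1)=1$, of the eigenvalues with respect to $\bar g$ (the principal radii of curvature) of $r_{ij}=\bar\nabla_i\bar\nabla_jh+\bar g_{ij}h$. Let $h_0$ be the support function of a smooth, closed, strictly convex hypersurface of $\mathbb{R}^{n+1}$ with the origin in its interior; that is, $h_0$ is smooth and positive on $\mathbb{S}^n$ and $\bar\nabla_i\bar\nabla_jh_0+\bar g_{ij}h_0$ is positive definite. Then there are positive constants $\gamma,a,b,c,d$, depending only on $n,k,p,\varphi$ and $h_0$, such that the following holds. Let $0<T\le\infty$ and let $h$ be any smooth solution on $\mathbb{S}^n\times[0,T)$ of the normalized flow \[\partial_\tau h=\varphi h^{2-p}\sigma_k-h\,\frac{\int_{\mathbb{S}^n}h\sigma_k\,dx}{\int_{\mathbb{S}^n}\frac1\varphi\,dx},\qquad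 h(\cdot,0)=h_0,\] such that each $h(\cdot,\tau)$ is positive with $\bar\nabla_i\bar\nabla_jh+\bar g_{ij}h$ positive definite. Then at every point of $\mathbb{S}^n\times[0,T)$ \[|\bar\nabla\log h|\le\gamma,\qquad a\le h\le b,\qquad c\le\sigma_k\le d.\] -/

import Mathlib

open MeasureTheory
open scoped Manifold ContDiff

noncomputable section

namespace SphereFlow

/-- The ambient Euclidean space `ℝ^{n+1}`. -/
abbrev E (n : ℕ) : Type := EuclideanSpace ℝ (Fin (n + 1))

/-- The unit sphere `𝕊^n ⊆ ℝ^{n+1}`. -/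
abbrev Sph (n : ℕ) : Type := Metric.sphere (0 : E n) 1

/-- The tangent space `T_x 𝕊^n = x^⊥`; its inner product, inherited from `ℝ^{n+1}`, is the round
metric `ḡ` at `x`. -/
abbrev Tan {n : ℕ} (x : Sph n) : Submodule ℝ (E n) := (Submodule.span ℝ {(x : E n)})ᗮ

/-- Radial projection `y ↦ y / |y|` of a nonzero vector to the unit sphere. -/
def radialProj {n : ℕ} (y : E n) (hy : y ≠ 0) : Sph n :=
  ⟨‖y‖⁻¹ • y, by
    rw [mem_sphere_zero_iff_norm, norm_smul, norm_inv, norm_norm,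
      inv_mul_cancel₀ (norm_ne_zero_iff.mpr hy)]⟩

open Classical in
/-- The extension of `f : 𝕊^n → ℝ` to `ℝ^{n+1} ∖ {0}` that is constant along rays
(with the irrelevant value `0` at the origin). -/
def radialExt {n : ℕ} (f : Sph n → ℝ) (y : E n) : ℝ :=
  if hy : y ≠ 0 then f (radialProj y hy) else 0

/-- The gradient `∇̄f` of `f : 𝕊^n → ℝ` for the round metric, as a vector of `ℝ^{n+1}`: the
Euclidean gradient of the radially constant extension, which at a point of the sphere is tangent
to the sphere and represents the differential of `f` there. -/
def sphGrad {n : ℕ} (f : Sph n → ℝ) (x : Sph n) : E n :=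
  gradient (radialExt f) (x : E n)

/-- The Hessian `∇̄²f` at `x` as an endomorphism of `T_x 𝕊^n`: `v ↦ ∇̄_v (∇̄f)`, where the
Levi-Civita connection of the round sphere is the tangential part of the Euclidean derivative.
(The field `gradient (radialExt f)` extends `∇̄f` to a neighbourhood of the sphere.) -/
def sphHess {n : ℕ} (f : Sph n → ℝ) (x : Sph n) : Tan x →ₗ[ℝ] Tan x :=
  ((Tan x).orthogonalProjectionOnto ∘L
    (fderiv ℝ (gradient (radialExt f)) (x : E n)) ∘L (Tan x).subtypeL : Tan x →L[ℝ] Tan x)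

/-- The tensor `r = ∇̄²h + h ḡ` at `x`, as an endomorphism of `T_x 𝕊^n` (an index raised by `ḡ`). -/
def radiiMap {n : ℕ} (h : Sph n → ℝ) (x : Sph n) : Tan x →ₗ[ℝ] Tan x :=
  sphHess h x + h x • LinearMap.id

/-- The principal radii of curvature at `x`: the eigenvalues of `r` with respect to `ḡ`, listed with
multiplicity. -/
def principalRadii {n : ℕ} (h : Sph n → ℝ) (x : Sph n) : Multiset ℝ :=
  (radiiMap h x).charpoly.roots

/-- `σ_k`: the `k`-th elementary symmetric polynomial of the principal radii of curvature,
normalized so that `σ_k(1, …, 1) = 1`. -/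
def sigma {n : ℕ} (k : ℕ) (h : Sph n → ℝ) (x : Sph n) : ℝ :=
  (principalRadii h x).esymm k / (n.choose k : ℝ)

/-- Integration over `𝕊^n` with respect to the surface measure `dx`. -/
def sphIntegral {n : ℕ} (f : Sph n → ℝ) : ℝ :=
  ∫ x, f x ∂((volume : Measure (E n)).toSphere)

/-- `h` is the support function of a smooth, closed, strictly convex hypersurface of `ℝ^{n+1}`
(namely of the image of `x ↦ h(x) x + ∇̄h(x)`) that encloses the origin in its interior:
`h` is smooth and positive, and `r = ∇̄²h + h ḡ` is positive definite. -/
structure IsConvexSupport {n : ℕ} (h : Sph n → ℝ) : Prop where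
  smooth : ContMDiff (𝓡 n) 𝓘(ℝ, ℝ) ∞ h
  pos : ∀ x, 0 < h x
  convex : ∀ x, ∀ v : Tan x, v ≠ 0 → 0 < inner ℝ (radiiMap h x v) v

/-- The time interval `[0, T)`, where `0 < T ≤ ∞`. -/
def timeInterval (T : EReal) : Set ℝ := {τ : ℝ | 0 ≤ τ ∧ (τ : EReal) < T}

/-- `h`, where `h τ` is the support function at time `τ`, is a smooth, strictly convex solution on
`[0, T)`, with initial value `h₀`, of the normalized flow
`∂_τ h = φ h^{2-p} σ_k - h (∫ h σ_k dx) / (∫ φ⁻¹ dx)`. -/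
structure IsNormalizedFlow {n : ℕ} (k : ℕ) (p : ℝ) (φ : Sph n → ℝ) (h₀ : Sph n → ℝ)
    (T : EReal) (h : ℝ → Sph n → ℝ) : Prop where
  smooth : ContMDiffOn (𝓘(ℝ, ℝ).prod (𝓡 n)) 𝓘(ℝ, ℝ) ∞
    (fun q : ℝ × Sph n => h q.1 q.2) (timeInterval T ×ˢ Set.univ)
  convex : ∀ τ ∈ timeInterval T, IsConvexSupport (h τ)
  initial : h 0 = h₀
  evolution : ∀ τ ∈ timeInterval T, ∀ x,
    HasDerivWithinAt (fun s => h s x)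
      (φ x * h τ x ^ (2 - p) * sigma k (h τ) x
        - h τ x * (sphIntegral (fun y => h τ y * sigma k (h τ) y)
            / sphIntegral (fun y => 1 / φ y)))
      (timeInterval T) τ

end SphereFlow

end

/-! The flow reads `∂_τ log h = Q - η`, where `Q = φ h^{1-p} σ_k` (`speed`) and `η` (`normFactor`)
depends on time only. The central quantity is the two-point function `Q(x) h(y)^β` with `β = p - 1 -
k ≥ 0`. At a spatial maximum `(x, y)` the point `x` maximizes `Q`; with `c = Q(x) - η`, the function
`c h - ∂_τ h` is nonnegative and vanishes at `x`, so `r[∂_τ h] ≤ c r[h]` there. Monotonicity and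
homogeneity of `σ_k` give `∂_τ log σ_k ≤ k c`, hence `∂_τ log Q ≤ -β c` at `x`, while `h(y)^β`
contributes `β (Q(y) - η) ≤ β c`. The nonlocal term cancels and the maximum cannot grow; the minimum
is symmetric (`IsNormalizedFlow.speed_mul_le`, `IsNormalizedFlow.le_speed_mul`). On the diagonal `x
= y` the quantity is `φ σ_k / h^k`, so `σ_k / h^k` stays between positive constants
(`exists_sigma_pinching`).

The upper bound `σ_k ≤ C h^k` alone bounds the oscillation of a convex support function
(`exists_harnack`), by touching it from below with a multiple of the barrier `e^{L⟨y, e⟩}`, `e` a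
maximum point. Consequently `η` is comparable to `h^{k+1}` at every point. At a space-time minimum
or maximum of `h` the sign of `∂_τ h` compares `Q` with `η`, and touching by constants compares
`σ_k` with `h^k`; together these bound `h^p` on both sides (`exists_support_bounds`). The bounds on
`σ_k` follow from the pinching. The gradient bound is convexity along great circles: `|∇̄h| ≤ max h`
(`norm_sphGrad_le`), so `|∇̄ log h| ≤ b / a`.

The maximum principle is run on backward differences in time: `σ_k` is never differentiated, only
compared through order relations between the tensors `r`. -/

/-! ### Monotonicity of sums of principal minors -/

/-- The sum of the principal minors of order `k` of a square matrix. -/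
def Matrix.minorSum {m : Type*} [Fintype m] [DecidableEq m] (M : Matrix m m ℝ) (k : ℕ) : ℝ :=
  ∑ s ∈ Finset.univ.powersetCard k,
    (M.submatrix (Subtype.val : s → m) (Subtype.val : s → m)).det

theorem Matrix.PosSemidef.one_le_det_one_add {m : Type*} [Fintype m] [DecidableEq m]
    {P : Matrix m m ℝ} (hP : P.PosSemidef) : 1 ≤ (1 + P).det := by
  have hs : (1 + P) = (Unitary.conjStarAlgAut ℝ _ hP.1.eigenvectorUnitary)
      (Matrix.diagonal (fun i => 1 + hP.1.eigenvalues i)) := by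
    conv_lhs => rw [hP.1.spectral_theorem]
    rw [← map_one (Unitary.conjStarAlgAut ℝ (Matrix m m ℝ) hP.1.eigenvectorUnitary), ← map_add]
    congr 1
    rw [← Matrix.diagonal_one, Matrix.diagonal_add]
    rfl
  rw [hs, Unitary.conjStarAlgAut_apply, Matrix.det_mul_right_comm, ← Unitary.coe_star,
    Unitary.coe_mul_star_self, one_mul, Matrix.det_diagonal]
  exact Finset.one_le_prod fun i _ => le_add_of_nonneg_right (hP.eigenvalues_nonneg i)

-- If `A = CᴴC` with `C` invertible, then `B = Cᴴ(1 + P)C` with `P ≥ 0`, and `det (1 + P) ≥ 1`. For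
-- singular `A` the left side is zero.
open scoped MatrixOrder in
theorem Matrix.PosSemidef.det_le_det {m : Type*} [Fintype m] [DecidableEq m]
    {A B : Matrix m m ℝ} (hA : A.PosSemidef) (hAB : (B - A).PosSemidef) : A.det ≤ B.det := by
  have hB : B.PosSemidef := by simpa using hA.add hAB
  by_cases h0 : A.det = 0
  · rw [h0]; exact hB.det_nonneg
  obtain ⟨C, hAC⟩ : ∃ C : Matrix m m ℝ, A = C.conjTranspose * C :=
    CStarAlgebra.nonneg_iff_eq_star_mul_self.mp hA.nonneg
  have hCdet : IsUnit C.det := by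
    rw [isUnit_iff_ne_zero]
    rintro h
    exact h0 (by rw [hAC, Matrix.det_mul, h, mul_zero])
  set P := (C⁻¹).conjTranspose * (B - A) * C⁻¹
  have hP : P.PosSemidef := hAB.conjTranspose_mul_mul_same _
  have hB' : B = C.conjTranspose * (1 + P) * C := by
    have h1 : C.conjTranspose * (C⁻¹).conjTranspose = 1 := by
      rw [← Matrix.conjTranspose_mul, Matrix.nonsing_inv_mul _ hCdet, Matrix.conjTranspose_one]
    have h2 : C⁻¹ * C = 1 := Matrix.nonsing_inv_mul _ hCdet
    have : C.conjTranspose * P * C = B - A := by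
      calc C.conjTranspose * P * C
          = (C.conjTranspose * (C⁻¹).conjTranspose) * (B - A) * (C⁻¹ * C) := by
            simp only [P, Matrix.mul_assoc]
        _ = B - A := by rw [h1, h2]; simp
    rw [Matrix.mul_add, Matrix.add_mul, this, Matrix.mul_one, ← hAC]; simp
  have hd : A.det = C.det * C.det := by
    rw [hAC, Matrix.det_mul, Matrix.det_conjTranspose]; simp
  have : B.det = C.det * C.det * (1 + P).det := by
    rw [hB', Matrix.det_mul, Matrix.det_mul, Matrix.det_conjTranspose]; simp; ring
  rw [this, hd]
  exact le_mul_of_one_le_right (mul_self_nonneg _) hP.one_le_det_one_add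

theorem Matrix.PosSemidef.minorSum_le {m : Type*} [Fintype m] [DecidableEq m]
    {A B : Matrix m m ℝ} (hA : A.PosSemidef) (hAB : (B - A).PosSemidef) (k : ℕ) :
    A.minorSum k ≤ B.minorSum k := by
  refine Finset.sum_le_sum fun s _ => ?_
  refine Matrix.PosSemidef.det_le_det (hA.submatrix _) ?_
  exact hAB.submatrix _

theorem Matrix.continuous_minorSum {m : Type*} [Fintype m] [DecidableEq m] (k : ℕ) :
    Continuous fun M : Matrix m m ℝ => M.minorSum k :=
  continuous_finsetSum _ fun _ _ => (continuous_id.matrix_submatrix _ _).matrix_det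

theorem Matrix.charpoly_coeff_eq_minorSum {m : Type*} [Fintype m] [DecidableEq m]
    (M : Matrix m m ℝ) {k : ℕ} (hk : k ≤ Fintype.card m) :
    M.charpoly.coeff (Fintype.card m - k) = (-1) ^ k * M.minorSum k :=
  M.charpoly_coeff_eq_sum_minors k hk

/-! ### Elementary symmetric functions of the eigenvalues of a symmetric operator -/

section Symmetric

variable {V : Type*} [NormedAddCommGroup V] [InnerProductSpace ℝ V] [FiniteDimensional ℝ V]

theorem LinearMap.IsSymmetric.charpoly_coeff_eq_esymm {T : V →ₗ[ℝ] V} (hT : T.IsSymmetric)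
    {k : ℕ} (hk : k ≤ Module.finrank ℝ V) :
    T.charpoly.coeff (Module.finrank ℝ V - k) = (-1) ^ k * T.charpoly.roots.esymm k := by
  have h := Polynomial.coeff_eq_esymm_roots_of_splits hT.splits_charpoly
    (k := Module.finrank ℝ V - k) (by rw [LinearMap.charpoly_natDegree]; omega)
  rw [h, T.charpoly_monic.leadingCoeff, LinearMap.charpoly_natDegree, one_mul,
    Nat.sub_sub_self hk]

/-- Both sides are, up to the same sign, a coefficient of the characteristic polynomial. Minors are
polynomial in the entries, which gives monotonicity, homogeneity and continuity of `σ_k` without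
following individual eigenvalues. -/
theorem LinearMap.IsSymmetric.esymm_eq_minorSum {T : V →ₗ[ℝ] V} (hT : T.IsSymmetric)
    {k : ℕ} (hk : k ≤ Module.finrank ℝ V) {ι : Type*} [Fintype ι] [DecidableEq ι]
    (b : Module.Basis ι ℝ V) :
    T.charpoly.roots.esymm k = (T.toMatrix b b).minorSum k := by
  have hc : Fintype.card ι = Module.finrank ℝ V := (Module.finrank_eq_card_basis b).symm
  have h1 := hT.charpoly_coeff_eq_esymm hk
  have h2 := (T.toMatrix b b).charpoly_coeff_eq_minorSum (k := k) (by omega)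
  rw [LinearMap.charpoly_toMatrix, hc, h1] at h2
  exact mul_left_cancel₀ (pow_ne_zero _ (by norm_num)) h2

theorem LinearMap.IsPositive.esymm_le {S T : V →ₗ[ℝ] V} (hS : S.IsPositive)
    (hT : T.IsSymmetric) (hST : ∀ v, inner ℝ (S v) v ≤ inner ℝ (T v) v)
    {k : ℕ} (hk : k ≤ Module.finrank ℝ V) :
    S.charpoly.roots.esymm k ≤ T.charpoly.roots.esymm k := by
  let b := stdOrthonormalBasis ℝ V
  rw [hS.1.esymm_eq_minorSum hk b.toBasis, hT.esymm_eq_minorSum hk b.toBasis]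
  refine Matrix.PosSemidef.minorSum_le ((LinearMap.posSemidef_toMatrix_iff b).mpr hS) ?_ k
  rw [← map_sub]
  refine (LinearMap.posSemidef_toMatrix_iff b).mpr ⟨hT.sub hS.1, fun v => ?_⟩
  simpa [inner_sub_left] using hST v

theorem LinearMap.IsSymmetric.esymm_smul {T : V →ₗ[ℝ] V} (hT : T.IsSymmetric) (c : ℝ)
    {k : ℕ} (hk : k ≤ Module.finrank ℝ V) :
    (c • T).charpoly.roots.esymm k = c ^ k * T.charpoly.roots.esymm k := by
  let b := stdOrthonormalBasis ℝ V
  have hcT : (c • T).IsSymmetric := fun v w => by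
    simp [inner_smul_left, inner_smul_right, hT v w]
  rw [hcT.esymm_eq_minorSum hk b.toBasis, hT.esymm_eq_minorSum hk b.toBasis]
  simp only [Matrix.minorSum, Finset.mul_sum]
  refine Finset.sum_congr rfl fun s hs => ?_
  rw [map_smul, Matrix.submatrix_smul, Pi.smul_apply, Pi.smul_apply, Matrix.det_smul]
  simp [(Finset.mem_powersetCard.mp hs).2]

theorem LinearMap.esymm_id {k : ℕ} (hk : k ≤ Module.finrank ℝ V) :
    (LinearMap.id : V →ₗ[ℝ] V).charpoly.roots.esymm k = (Module.finrank ℝ V).choose k := by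
  let b := stdOrthonormalBasis ℝ V
  rw [LinearMap.IsSymmetric.id.esymm_eq_minorSum hk b.toBasis, LinearMap.toMatrix_id,
    Matrix.minorSum, Finset.sum_congr rfl (g := fun _ => (1 : ℝ))]
  · simp [Finset.card_powersetCard]
  · intro s _
    rw [Matrix.submatrix_one _ Subtype.val_injective, Matrix.det_one]

/-- If all eigenvalues are at least `α` and one of them is at least `B`, then `e_k ≥ α^{k-1} B`. -/
theorem LinearMap.IsSymmetric.le_esymm {T : V →ₗ[ℝ] V} (hT : T.IsSymmetric)
    {k : ℕ} (hk1 : 1 ≤ k) (hk : k ≤ Module.finrank ℝ V) {α B : ℝ} (hα : 0 < α)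
    (hTα : ∀ v, α * ‖v‖ ^ 2 ≤ inner ℝ (T v) v) {u : V} (hu : u ≠ 0)
    (hTu : B * ‖u‖ ^ 2 ≤ inner ℝ (T u) u) :
    α ^ (k - 1) * B ≤ T.charpoly.roots.esymm k := by
  set lam := hT.eigenvalues rfl
  set b := hT.eigenvectorBasis rfl
  have hlam : ∀ i, α ≤ lam i := fun i => by
    have := hTα (b i)
    rw [hT.apply_eigenvectorBasis, RCLike.ofReal_real_eq_id, id_eq, inner_smul_left,
      real_inner_self_eq_norm_sq] at this
    simpa [b, lam] using this
  have hexp : inner ℝ (T u) u = ∑ i, lam i * (inner ℝ (b i) u) ^ 2 := by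
    rw [← b.sum_inner_mul_inner]
    refine Finset.sum_congr rfl fun i _ => ?_
    rw [hT, hT.apply_eigenvectorBasis, RCLike.ofReal_real_eq_id, id_eq, inner_smul_right,
      real_inner_comm]
    ring
  have hnorm : ‖u‖ ^ 2 = ∑ i, (inner ℝ (b i) u) ^ 2 := by
    rw [← b.sum_sq_norm_inner_right u]
    simp
  -- The Rayleigh quotient at `u` is a weighted mean of the eigenvalues, so some eigenvalue is at
  -- least `B`.
  obtain ⟨i, hi⟩ : ∃ i, B ≤ lam i := by
    by_contra! hcon
    have hle : ∑ i, (lam i - B) * (inner ℝ (b i) u) ^ 2 < 0 := by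
      have hne : ∃ i, inner ℝ (b i) u ≠ 0 := by
        by_contra! h
        apply hu
        have : ‖u‖ ^ 2 = 0 := by rw [hnorm]; simp [h]
        simpa using this
      obtain ⟨i, hi⟩ := hne
      refine Finset.sum_neg' (fun j _ => ?_) ⟨i, Finset.mem_univ _, ?_⟩
      · exact mul_nonpos_of_nonpos_of_nonneg (by linarith [hcon j]) (sq_nonneg _)
      · exact mul_neg_of_neg_of_pos (by linarith [hcon i]) (by positivity)
    simp only [sub_mul, Finset.sum_sub_distrib, ← Finset.mul_sum] at hle
    rw [← hexp, ← hnorm] at hle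
    linarith
  rw [hT.roots_charpoly_eq_eigenvalues rfl, RCLike.ofReal_real_eq_id]
  simp only [Function.id_comp]
  rw [Finset.esymm_map_val]
  -- A single monomial suffices: all are nonnegative, and one containing the large eigenvalue is
  -- bounded below by `α^{k-1} B`.
  obtain ⟨I, hiI, -, hI⟩ := Finset.exists_subsuperset_card_eq
    (Finset.subset_univ ({i} : Finset (Fin (Module.finrank ℝ V)))) (n := k)
    (by simpa using hk1) (by simpa using hk)
  have hmem : i ∈ I := hiI (by simp)
  refine le_trans ?_ (Finset.single_le_sum (f := fun t => ∏ j ∈ t, lam j) (fun t _ =>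
    Finset.prod_nonneg fun j _ => hα.le.trans (hlam j))
    (Finset.mem_powersetCard.mpr ⟨Finset.subset_univ I, hI⟩))
  rw [← Finset.prod_erase_mul I lam hmem]
  have hp : α ^ (k - 1) ≤ ∏ j ∈ I.erase i, lam j := by
    rw [← hI, ← Finset.card_erase_of_mem hmem, ← Finset.prod_const]
    exact Finset.prod_le_prod (fun _ _ => hα.le) fun j _ => hlam j
  have hpos : 0 < lam i := hα.trans_le (hlam i)
  calc α ^ (k - 1) * B ≤ α ^ (k - 1) * lam i := by gcongr
    _ ≤ _ := by gcongr

/-- Extending an operator on a subspace `W` by zero on `Wᗮ` does not change the elementary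
symmetric functions of its eigenvalues. -/
theorem LinearMap.IsSymmetric.esymm_eq_minorSum_extend {W : Submodule ℝ V} {T : W →ₗ[ℝ] W}
    (hT : T.IsSymmetric) {k : ℕ} (hk : k ≤ Module.finrank ℝ W) {ι : Type*} [Fintype ι]
    [DecidableEq ι] (b : Module.Basis ι ℝ V) :
    T.charpoly.roots.esymm k = ((W.subtype ∘ₗ T ∘ₗ
      (W.orthogonalProjectionOnto : V →ₗ[ℝ] W)).toMatrix b b).minorSum k := by
  let c := Module.finBasis ℝ W
  have hcb : Fintype.card ι = Module.finrank ℝ V := (Module.finrank_eq_card_basis b).symm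
  have hle : Module.finrank ℝ W ≤ Module.finrank ℝ V := Submodule.finrank_le W
  set A := W.subtype.toMatrix c b
  set B := (T ∘ₗ (W.orthogonalProjectionOnto : V →ₗ[ℝ] W)).toMatrix b c
  have hAB : (W.subtype ∘ₗ T ∘ₗ (W.orthogonalProjectionOnto : V →ₗ[ℝ] W)).toMatrix b b
      = A * B := LinearMap.toMatrix_comp b c b _ _
  have hBA : B * A = T.toMatrix c c := by
    rw [← LinearMap.toMatrix_comp c b c]
    congr 1
    ext v
    simp
  -- `AB` and `BA` have the same characteristic polynomial up to a power of `X`, which only shifts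
  -- the coefficients.
  have h := Matrix.charpoly_mul_comm_of_le A B (by simpa [hcb] using hle)
  have h1 := hT.charpoly_coeff_eq_esymm hk
  have h2 := (A * B).charpoly_coeff_eq_minorSum (k := k) (by omega)
  rw [h, hBA, LinearMap.charpoly_toMatrix, Fintype.card_fin, hcb,
    show Module.finrank ℝ V - k = (Module.finrank ℝ W - k) +
      (Module.finrank ℝ V - Module.finrank ℝ W) by omega,
    Polynomial.coeff_X_pow_mul, h1] at h2
  rw [hAB]
  exact mul_left_cancel₀ (pow_ne_zero _ (by norm_num)) h2

end Symmetric

/-! ### Smoothness of radially constant extensions -/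

namespace SphereFlow

variable {n : ℕ}

theorem coe_ne_zero (x : Sph n) : (x : E n) ≠ 0 := ne_zero_of_mem_unit_sphere x

theorem norm_coe (x : Sph n) : ‖(x : E n)‖ = 1 := norm_eq_of_mem_sphere x

theorem radialExt_of_ne (f : Sph n → ℝ) {y : E n} (hy : y ≠ 0) :
    radialExt f y = f (radialProj y hy) := by
  rw [radialExt, dif_pos hy]

theorem radialProj_coe (x : Sph n) : radialProj (x : E n) (coe_ne_zero x) = x := by
  ext1
  simp [radialProj]

@[simp]
theorem radialExt_coe (f : Sph n → ℝ) (x : Sph n) : radialExt f (x : E n) = f x := by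
  rw [radialExt_of_ne f (coe_ne_zero x), radialProj_coe]

theorem radialProj_smul {s : ℝ} (hs : 0 < s) {y : E n} (hy : y ≠ 0) :
    radialProj (s • y) (smul_ne_zero hs.ne' hy) = radialProj y hy := by
  ext1
  simp only [radialProj, norm_smul, Real.norm_of_nonneg hs.le, smul_smul, mul_inv]
  congr 1
  field_simp

theorem radialExt_smul (f : Sph n → ℝ) {s : ℝ} (hs : 0 < s) {y : E n} (hy : y ≠ 0) :
    radialExt f (s • y) = radialExt f y := by
  rw [radialExt_of_ne f hy, radialExt_of_ne f (smul_ne_zero hs.ne' hy), radialProj_smul hs hy]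

instance : Nonempty (Sph n) := (NormedSpace.sphere_nonempty.mpr zero_le_one).to_subtype

/-- Radial projection to the sphere, with an arbitrary value at the origin. -/
noncomputable def sphProj (y : E n) : Sph n := by
  classical
  exact if hy : y ≠ 0 then radialProj y hy else Classical.arbitrary _

theorem radialExt_eq_sphProj (f : Sph n → ℝ) {y : E n} (hy : y ≠ 0) :
    radialExt f y = f (sphProj y) := by
  rw [radialExt_of_ne f hy, sphProj, dif_pos hy]

theorem contMDiffOn_sphProj : ContMDiffOn 𝓘(ℝ, E n) (𝓡 n) ∞ (sphProj (n := n)) {0}ᶜ := by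
  intro y hy
  apply ContMDiffAt.contMDiffWithinAt
  -- Restricting the codomain to the sphere needs a map that is smooth on a whole manifold, so the
  -- punctured space is treated as an open submanifold.
  let U : TopologicalSpace.Opens (E n) := ⟨{0}ᶜ, isOpen_compl_singleton⟩
  have key : ContMDiff 𝓘(ℝ, E n) (𝓡 n) ∞ (fun u : U => sphProj (u : E n)) := by
    have h1 : ContMDiff 𝓘(ℝ, E n) 𝓘(ℝ, E n) ∞ (fun u : U => ‖(u : E n)‖⁻¹ • (u : E n)) := by
      intro u
      refine (contMDiffAt_subtype_iff (f := fun y : E n => ‖y‖⁻¹ • y)).mpr ?_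
      apply ContDiffAt.contMDiffAt
      have hu : (u : E n) ≠ 0 := u.2
      exact ((contDiffAt_norm ℝ hu).inv (norm_ne_zero_iff.mpr hu)).smul contDiffAt_id
    have h2 : ∀ u : U, ‖(u : E n)‖⁻¹ • (u : E n) ∈ Metric.sphere (0 : E n) 1 := fun u => by
      have hu : (u : E n) ≠ 0 := u.2
      exact (radialProj (u : E n) hu).2
    have := Fact.mk (@finrank_euclideanSpace_fin ℝ _ (n + 1))
    have h3 := h1.codRestrict_sphere (n := n) h2
    have h4 : (fun u : U => sphProj (u : E n)) = Set.codRestrict _ _ h2 := by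
      ext1 u
      have hu : (u : E n) ≠ 0 := u.2
      rw [sphProj, dif_pos hu]
      rfl
    rw [h4]
    exact h3
  exact contMDiffAt_subtype_iff.mp (key ⟨y, hy⟩)

theorem contDiffOn_radialExt {f : Sph n → ℝ} (hf : ContMDiff (𝓡 n) 𝓘(ℝ, ℝ) ∞ f) :
    ContDiffOn ℝ ∞ (radialExt f) {0}ᶜ := by
  rw [← contMDiffOn_iff_contDiffOn]
  refine (hf.comp_contMDiffOn contMDiffOn_sphProj).congr fun y hy => ?_
  exact radialExt_eq_sphProj f hy

theorem contDiffOn_radialExt_prod {h : ℝ → Sph n → ℝ} {I : Set ℝ}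
    (hh : ContMDiffOn (𝓘(ℝ, ℝ).prod (𝓡 n)) 𝓘(ℝ, ℝ) ∞
      (fun q : ℝ × Sph n => h q.1 q.2) (I ×ˢ Set.univ)) :
    ContDiffOn ℝ ∞ (fun q : ℝ × E n => radialExt (h q.1) q.2) (I ×ˢ {0}ᶜ) := by
  rw [← contMDiffOn_iff_contDiffOn, modelWithCornersSelf_prod, ← chartedSpaceSelf_prod]
  have h1 : ContMDiffOn (𝓘(ℝ, ℝ).prod 𝓘(ℝ, E n)) (𝓘(ℝ, ℝ).prod (𝓡 n)) ∞
      (fun q : ℝ × E n => (q.1, sphProj q.2)) (I ×ˢ {0}ᶜ) :=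
    contMDiffOn_fst.prodMk (contMDiffOn_sphProj.comp contMDiffOn_snd fun q hq => hq.2)
  refine (hh.comp h1 fun q hq => ⟨hq.1, trivial⟩).congr fun q hq => ?_
  exact radialExt_eq_sphProj _ hq.2

end SphereFlow

/-! ### Second derivatives along lines and the second-order condition at a minimum -/

theorem two_le_infty : (2 : ℕ∞ω) ≤ ∞ :=
  WithTop.coe_le_coe.mpr (le_top : (2 : ℕ∞) ≤ ⊤)

theorem hasDerivAt_comp_line {V : Type*} [NormedAddCommGroup V] [NormedSpace ℝ V]
    {G : V → ℝ} {x v : V} {s : ℝ} (hG : DifferentiableAt ℝ G (x + s • v)) :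
    HasDerivAt (fun s : ℝ => G (x + s • v)) (fderiv ℝ G (x + s • v) v) s := by
  have h1 : HasDerivAt (fun s : ℝ => x + s • v) v s := by
    simpa using ((hasDerivAt_id s).smul_const v).const_add x
  exact hG.hasFDerivAt.comp_hasDerivAt s h1

theorem eventually_deriv_comp_line {V : Type*} [NormedAddCommGroup V] [NormedSpace ℝ V]
    {G : V → ℝ} {x : V} (hG : ContDiffAt ℝ 2 G x) (v : V) :
    deriv (fun s : ℝ => G (x + s • v)) =ᶠ[nhds 0] fun s => fderiv ℝ G (x + s • v) v := by
  have hc : Filter.Tendsto (fun s : ℝ => x + s • v) (nhds 0) (nhds x) := by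
    have : Continuous fun s : ℝ => x + s • v := by fun_prop
    simpa using this.tendsto 0
  have h1 : ∀ᶠ y in nhds x, DifferentiableAt ℝ G y :=
    (hG.eventually (by simp)).mono fun y hy => hy.differentiableAt (by norm_num)
  filter_upwards [hc.eventually h1] with s hs
  exact (hasDerivAt_comp_line hs).deriv

theorem deriv_deriv_comp_line {V : Type*} [NormedAddCommGroup V] [NormedSpace ℝ V]
    {G : V → ℝ} {x : V} (hG : ContDiffAt ℝ 2 G x) (v : V) :
    deriv (deriv fun s : ℝ => G (x + s • v)) 0 = fderiv ℝ (fderiv ℝ G) x v v := by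
  rw [(eventually_deriv_comp_line hG v).deriv_eq]
  have h2 : DifferentiableAt ℝ (fderiv ℝ G) (x + (0 : ℝ) • v) := by
    rw [zero_smul, add_zero]
    exact (hG.fderiv_right (m := 1) (by norm_num)).differentiableAt (by norm_num)
  have h1 : HasDerivAt (fun s : ℝ => x + s • v) v 0 := by
    simpa using ((hasDerivAt_id (0 : ℝ)).smul_const v).const_add x
  have h3 : HasDerivAt (fun s : ℝ => fderiv ℝ G (x + s • v)) (fderiv ℝ (fderiv ℝ G) x v) 0 := by
    have := h2.hasFDerivAt.comp_hasDerivAt (0 : ℝ) h1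
    rwa [zero_smul, add_zero] at this
  rw [(h3.clm_apply (hasDerivAt_const 0 v)).deriv, map_zero, add_zero]

/-- If the second derivative along a line were negative, the point would also be a local maximum on
that line. The restriction would then be locally constant, with zero second derivative. -/
theorem IsLocalMin.fderiv_fderiv_nonneg {V : Type*} [NormedAddCommGroup V] [NormedSpace ℝ V]
    {G : V → ℝ} {x : V} (hmin : IsLocalMin G x) (hG : ContDiffAt ℝ 2 G x) (v : V) :
    0 ≤ fderiv ℝ (fderiv ℝ G) x v v := by
  rw [← deriv_deriv_comp_line hG v]
  set g : ℝ → ℝ := fun s => G (x + s • v) with hg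
  have hc : Filter.Tendsto (fun s : ℝ => x + s • v) (nhds 0) (nhds x) := by
    have : Continuous fun s : ℝ => x + s • v := by fun_prop
    simpa using this.tendsto 0
  have hming : IsLocalMin g 0 := by
    have := hc.eventually hmin
    simpa [IsLocalMin, IsMinFilter, hg] using this
  have hd0 : deriv g 0 = 0 := hming.deriv_eq_zero
  have hcont : ContinuousAt g 0 := by
    have : ContinuousAt G (x + (0 : ℝ) • v) := by simpa using hG.continuousAt
    exact ContinuousAt.comp (f := fun s : ℝ => x + s • v) this (by fun_prop)
  by_contra! hneg
  have hmax : IsLocalMax g 0 := by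
    have hneg' : 0 < deriv (deriv (-g)) 0 := by
      rw [deriv.neg', deriv.fun_neg]
      linarith
    have := isLocalMin_of_deriv_deriv_pos hneg' (by rw [deriv.neg, hd0, neg_zero]) hcont.neg
    simpa using this.neg
  have hcst : g =ᶠ[nhds 0] fun _ => g 0 := by
    filter_upwards [hming, hmax] with s h1 h2
    exact le_antisymm h2 h1
  have hcst' : deriv g =ᶠ[nhds 0] fun _ => 0 := by
    refine hcst.eventuallyEq_nhds.mono fun s hs => ?_
    rw [hs.deriv_eq]
    simp
  rw [hcst'.deriv_eq] at hneg
  simp at hneg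

/-! ### The radii tensor as a quadratic form -/

namespace SphereFlow

variable {n : ℕ} {f g : Sph n → ℝ}

theorem contDiffAt_radialExt (hf : ContMDiff (𝓡 n) 𝓘(ℝ, ℝ) ∞ f) {y : E n} (hy : y ≠ 0) :
    ContDiffAt ℝ ∞ (radialExt f) y :=
  (contDiffOn_radialExt hf).contDiffAt (isOpen_compl_singleton.mem_nhds hy)

theorem inner_sphGrad (f : Sph n → ℝ) (x : Sph n) (v : E n) :
    inner ℝ (sphGrad f x) v = fderiv ℝ (radialExt f) (x : E n) v :=
  InnerProductSpace.toDual_symm_apply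

theorem inner_sphHess (f : Sph n → ℝ) (x : Sph n) (v w : Tan x) :
    inner ℝ (sphHess f x v) w = fderiv ℝ (fderiv ℝ (radialExt f)) (x : E n) (v : E n) (w : E n) := by
  have h : fderiv ℝ (gradient (radialExt f)) (x : E n) (v : E n) =
      (InnerProductSpace.toDual ℝ (E n)).symm
        (fderiv ℝ (fderiv ℝ (radialExt f)) (x : E n) (v : E n)) := by
    have : gradient (radialExt f) =
      (InnerProductSpace.toDual ℝ (E n)).symm ∘ (fderiv ℝ (radialExt f)) := rfl
    rw [this, LinearIsometryEquiv.comp_fderiv]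
    rfl
  change inner ℝ ((Tan x).orthogonalProjectionOnto
    (fderiv ℝ (gradient (radialExt f)) (x : E n) (v : E n))) w = _
  rw [Submodule.inner_orthogonalProjectionOnto_eq_of_mem_right, h,
    InnerProductSpace.toDual_symm_apply]

theorem inner_radiiMap (f : Sph n → ℝ) (x : Sph n) (v w : Tan x) :
    inner ℝ (radiiMap f x v) w =
      fderiv ℝ (fderiv ℝ (radialExt f)) (x : E n) (v : E n) (w : E n) +
        f x * inner ℝ (v : E n) (w : E n) := by
  rw [radiiMap, LinearMap.add_apply, inner_add_left, inner_sphHess, LinearMap.smul_apply,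
    LinearMap.id_apply, real_inner_smul_left, Submodule.coe_inner]

theorem radiiMap_isSymmetric (hf : ContMDiff (𝓡 n) 𝓘(ℝ, ℝ) ∞ f) (x : Sph n) :
    (radiiMap f x).IsSymmetric := by
  intro v w
  have hs : IsSymmSndFDerivAt ℝ (radialExt f) (x : E n) :=
    (contDiffAt_radialExt hf (coe_ne_zero x)).isSymmSndFDerivAt
      (by simpa using two_le_infty)
  rw [inner_radiiMap, real_inner_comm (radiiMap f x w), inner_radiiMap, hs.eq, real_inner_comm (v : E n)]

theorem finrank_tan (x : Sph n) : Module.finrank ℝ (Tan x) = n := by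
  have : Fact (Module.finrank ℝ (E n) = n + 1) := ⟨finrank_euclideanSpace_fin⟩
  exact Submodule.finrank_orthogonal_span_singleton (coe_ne_zero x)

/-- If `f ≤ g` with equality at `x`, the quadratic form of `∇̄²f + f ḡ` at `x` is at most that of
`∇̄²g + g ḡ`. -/
theorem inner_radiiMap_le_of_touching (hf : ContMDiff (𝓡 n) 𝓘(ℝ, ℝ) ∞ f)
    (hg : ContMDiff (𝓡 n) 𝓘(ℝ, ℝ) ∞ g) (hfg : ∀ y, f y ≤ g y) {x : Sph n} (hx : f x = g x)
    (v : Tan x) : inner ℝ (radiiMap f x v) v ≤ inner ℝ (radiiMap g x v) v := by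
  rw [inner_radiiMap, inner_radiiMap, hx]
  have hF := (contDiffAt_radialExt hf (coe_ne_zero x)).of_le (m := 2) two_le_infty
  have hG := (contDiffAt_radialExt hg (coe_ne_zero x)).of_le (m := 2) two_le_infty
  have hmin : IsLocalMin (fun y => radialExt g y - radialExt f y) (x : E n) := by
    filter_upwards [isOpen_compl_singleton.mem_nhds (coe_ne_zero x)] with y hy
    have hy' : y ≠ 0 := hy
    rw [radialExt_coe, radialExt_coe, hx, sub_self, radialExt_of_ne _ hy', radialExt_of_ne _ hy']
    linarith [hfg (radialProj y hy')]
  have h := hmin.fderiv_fderiv_nonneg (hG.sub hF) (v : E n)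
  have he : fderiv ℝ (fun y => radialExt g y - radialExt f y) =ᶠ[nhds (x : E n)]
      fun y => fderiv ℝ (radialExt g) y - fderiv ℝ (radialExt f) y := by
    filter_upwards [hF.eventually (by simp), hG.eventually (by simp)] with y h1 h2
    exact fderiv_fun_sub (h2.differentiableAt (by norm_num)) (h1.differentiableAt (by norm_num))
  rw [he.fderiv_eq, fderiv_fun_sub
    ((hG.fderiv_right (m := 1) (by norm_num)).differentiableAt (by norm_num))
    ((hF.fderiv_right (m := 1) (by norm_num)).differentiableAt (by norm_num))] at h
  simp only [_root_.sub_apply] at h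
  linarith

theorem radiiMap_const_mul (hf : ContMDiff (𝓡 n) 𝓘(ℝ, ℝ) ∞ f) (c : ℝ) (x : Sph n) :
    radiiMap (fun y => c * f y) x = c • radiiMap f x := by
  have hF := (contDiffAt_radialExt hf (coe_ne_zero x)).of_le (m := 2) two_le_infty
  have h1 : radialExt (fun y => c * f y) = fun y => c * radialExt f y := by
    ext y
    unfold radialExt
    split_ifs <;> simp
  have he : fderiv ℝ (fun y => c * radialExt f y) =ᶠ[nhds (x : E n)]
      fun y => c • fderiv ℝ (radialExt f) y := by
    filter_upwards [hF.eventually (by simp)] with y h1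
    exact fderiv_const_mul (h1.differentiableAt (by norm_num)) c
  ext1 v
  refine ext_inner_right ℝ fun w => ?_
  rw [inner_radiiMap, LinearMap.smul_apply, real_inner_smul_left, inner_radiiMap, h1,
    he.fderiv_eq, fderiv_fun_const_smul
      ((hF.fderiv_right (m := 1) (by norm_num)).differentiableAt (by norm_num))]
  simp only [_root_.smul_apply, smul_eq_mul]
  ring

theorem radiiMap_const (c : ℝ) (x : Sph n) :
    radiiMap (fun _ : Sph n => c) x = c • LinearMap.id := by
  have he : radialExt (fun _ : Sph n => c) =ᶠ[nhds (x : E n)] fun _ => c := by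
    filter_upwards [isOpen_compl_singleton.mem_nhds (coe_ne_zero x)] with y hy
    exact radialExt_of_ne _ hy
  have he' : fderiv ℝ (radialExt (fun _ : Sph n => c)) =ᶠ[nhds (x : E n)] fun _ => 0 := by
    refine he.eventuallyEq_nhds.mono fun s hs => ?_
    rw [hs.fderiv_eq]
    simp
  ext1 v
  refine ext_inner_right ℝ fun w => ?_
  rw [inner_radiiMap, he'.fderiv_eq]
  simp [real_inner_smul_left]

theorem fderiv_radialExt_self (f : Sph n → ℝ) {y : E n} (hy : y ≠ 0)
    (hf : DifferentiableAt ℝ (radialExt f) y) : fderiv ℝ (radialExt f) y y = 0 := by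
  have h : HasDerivAt (fun s : ℝ => radialExt f (y + s • y)) (fderiv ℝ (radialExt f) y y) 0 := by
    simpa using hasDerivAt_comp_line (x := y) (v := y) (s := 0) (by simpa using hf)
  have he : (fun s : ℝ => radialExt f (y + s • y)) =ᶠ[nhds 0] fun _ => radialExt f y := by
    filter_upwards [lt_mem_nhds (show (-1 : ℝ) < 0 by norm_num)] with s hs
    rw [show y + s • y = (1 + s) • y by rw [add_smul, one_smul], radialExt_smul f (by linarith) hy]
  rw [← h.deriv, he.deriv_eq]
  simp

end SphereFlow

/-! ### Convexity along great circles -/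

namespace SphereFlow

variable {n : ℕ} {f : Sph n → ℝ}

theorem mem_tan_iff {x : Sph n} {v : E n} : v ∈ Tan x ↔ inner ℝ (x : E n) v = 0 :=
  Submodule.mem_orthogonal_singleton_iff_inner_right

theorem inner_coe_tan (x : Sph n) (v : Tan x) : inner ℝ (x : E n) (v : E n) = 0 :=
  mem_tan_iff.mp v.2

/-- A function with `∇̄²f + f ḡ ≥ 0` lies above the restriction of its linear tangent function along
every great half-circle. -/
theorem great_circle_le (hf : ContMDiff (𝓡 n) 𝓘(ℝ, ℝ) ∞ f)
    (hr : ∀ x, ∀ v : Tan x, 0 ≤ inner ℝ (radiiMap f x v) v) (x : Sph n) {v : E n}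
    (hv : ‖v‖ = 1) (hxv : inner ℝ (x : E n) v = 0) {b : ℝ} (hb0 : 0 ≤ b) (hb : b ≤ Real.pi) :
    f x * Real.cos b + fderiv ℝ (radialExt f) (x : E n) v * Real.sin b ≤
      radialExt f (Real.cos b • (x : E n) + Real.sin b • v) := by
  set F := radialExt f
  let γ : ℝ → E n := fun θ => Real.cos θ • (x : E n) + Real.sin θ • v
  let γ' : ℝ → E n := fun θ => -Real.sin θ • (x : E n) + Real.cos θ • v
  have hxx : inner ℝ (x : E n) (x : E n) = 1 := by
    rw [real_inner_self_eq_norm_sq, norm_coe, one_pow]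
  have hvv : inner ℝ v v = 1 := by rw [real_inner_self_eq_norm_sq, hv, one_pow]
  have hvx : inner ℝ v (x : E n) = 0 := by rw [real_inner_comm, hxv]
  have hγn : ∀ θ, ‖γ θ‖ = 1 := fun θ => by
    have : ‖γ θ‖ ^ 2 = 1 := by
      rw [← real_inner_self_eq_norm_sq]
      simp only [γ, inner_add_left, inner_add_right, real_inner_smul_left, real_inner_smul_right,
        hxx, hvv, hxv, hvx]
      nlinarith [Real.sin_sq_add_cos_sq θ]
    nlinarith [norm_nonneg (γ θ)]
  have hγ0 : ∀ θ, γ θ ≠ 0 := fun θ h => by simpa [h] using hγn θ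
  have hγγ' : ∀ θ, inner ℝ (γ θ) (γ' θ) = 0 := fun θ => by
    simp only [γ, γ', inner_add_left, inner_add_right, real_inner_smul_left,
      real_inner_smul_right, hxx, hvv, hxv, hvx]
    ring
  have hdγ : ∀ θ, HasDerivAt γ (γ' θ) θ := fun θ =>
    ((Real.hasDerivAt_cos θ).smul_const _).add ((Real.hasDerivAt_sin θ).smul_const _)
  have hdγ' : ∀ θ, HasDerivAt γ' (-γ θ) θ := fun θ => by
    have := ((Real.hasDerivAt_sin θ).neg.smul_const (x : E n)).add
      ((Real.hasDerivAt_cos θ).smul_const v)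
    refine this.congr_deriv ?_
    simp only [γ, neg_add, neg_smul]
  have hF : ∀ θ, ContDiffAt ℝ 2 F (γ θ) := fun θ =>
    (contDiffAt_radialExt hf (hγ0 θ)).of_le two_le_infty
  have hF1 : ∀ θ, DifferentiableAt ℝ F (γ θ) := fun θ => (hF θ).differentiableAt (by norm_num)
  have hF2 : ∀ θ, DifferentiableAt ℝ (fderiv ℝ F) (γ θ) := fun θ =>
    ((hF θ).fderiv_right (m := 1) (by norm_num)).differentiableAt (by norm_num)
  have hd1 : ∀ θ, HasDerivAt (fun θ => F (γ θ)) (fderiv ℝ F (γ θ) (γ' θ)) θ := fun θ =>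
    (hF1 θ).hasFDerivAt.comp_hasDerivAt θ (hdγ θ)
  -- Since `γ'' = -γ` is radial and `F` is constant along rays, the acceleration term drops out.
  have hd2 : ∀ θ, HasDerivAt (fun θ => fderiv ℝ F (γ θ) (γ' θ))
      (fderiv ℝ (fderiv ℝ F) (γ θ) (γ' θ) (γ' θ)) θ := fun θ => by
    have h1 : HasDerivAt (fun θ => fderiv ℝ F (γ θ)) (fderiv ℝ (fderiv ℝ F) (γ θ) (γ' θ)) θ :=
      (hF2 θ).hasFDerivAt.comp_hasDerivAt θ (hdγ θ)
    have h2 := h1.clm_apply (hdγ' θ)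
    rwa [map_neg, fderiv_radialExt_self f (hγ0 θ) (hF1 θ), neg_zero, add_zero] at h2
  have hconv : ∀ θ, 0 ≤ fderiv ℝ (fderiv ℝ F) (γ θ) (γ' θ) (γ' θ) + F (γ θ) := fun θ => by
    let z : Sph n := ⟨γ θ, mem_sphere_zero_iff_norm.mpr (hγn θ)⟩
    let w : Tan z := ⟨γ' θ, mem_tan_iff.mpr (hγγ' θ)⟩
    have h := hr z w
    rw [inner_radiiMap] at h
    have hw : inner ℝ (γ' θ) (γ' θ) = 1 := by
      simp only [γ', inner_add_left, inner_add_right, real_inner_smul_left,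
        real_inner_smul_right, hxx, hvv, hxv, hvx]
      nlinarith [Real.sin_sq_add_cos_sq θ]
    have hz : F (γ θ) = f z := radialExt_coe f z
    rw [hz]
    simp only [w, z, hw, mul_one] at h
    exact h
  -- Wronskian of `F ∘ γ` with the solution `sin (b - θ)` of `u'' + u = 0`: its derivative is `(F''
  -- + F) sin (b - θ)`, which is nonnegative on `[0, b]` because `b ≤ π`.
  let κ : ℝ → ℝ := fun θ =>
    fderiv ℝ F (γ θ) (γ' θ) * Real.sin (b - θ) + F (γ θ) * Real.cos (b - θ)
  have hsub : ∀ θ, HasDerivAt (fun θ => b - θ) (-1) θ := fun θ => by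
    simpa using (hasDerivAt_id θ).const_sub b
  have hκ : ∀ θ, HasDerivAt κ
      ((fderiv ℝ (fderiv ℝ F) (γ θ) (γ' θ) (γ' θ) + F (γ θ)) * Real.sin (b - θ)) θ := fun θ => by
    have := ((hd2 θ).mul (hsub θ).sin).add ((hd1 θ).mul (hsub θ).cos)
    refine this.congr_deriv ?_
    ring
  have hmono : MonotoneOn κ (Set.Icc 0 b) := by
    refine monotoneOn_of_deriv_nonneg (convex_Icc 0 b)
      (fun θ _ => (hκ θ).continuousAt.continuousWithinAt)
      (fun θ _ => (hκ θ).differentiableAt.differentiableWithinAt) fun θ hθ => ?_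
    rw [interior_Icc] at hθ
    rw [(hκ θ).deriv]
    exact mul_nonneg (hconv θ)
      (Real.sin_nonneg_of_nonneg_of_le_pi (by linarith [hθ.2]) (by linarith [hθ.1]))
  have h := hmono (Set.left_mem_Icc.mpr hb0) (Set.right_mem_Icc.mpr hb0) hb0
  have hγ00 : γ 0 = x := by simp [γ]
  have hγ'0 : γ' 0 = v := by simp [γ']
  have hFx : F (x : E n) = f x := radialExt_coe f x
  simp only [κ, hγ00, hγ'0, hFx, sub_zero, sub_self, Real.sin_zero, Real.cos_zero, mul_zero,
    mul_one, zero_add] at h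
  linarith

theorem norm_inv_norm_smul {v : E n} (hv : v ≠ 0) : ‖‖v‖⁻¹ • v‖ = 1 := by
  rw [norm_smul, norm_inv, norm_norm, inv_mul_cancel₀ (norm_ne_zero_iff.mpr hv)]

/-- A quarter of a great circle in the direction of the gradient ends at a point where the tangent
linear function equals `|∇̄f|`, and `f` lies above that function. -/
theorem norm_sphGrad_le (hf : ContMDiff (𝓡 n) 𝓘(ℝ, ℝ) ∞ f)
    (hr : ∀ x, ∀ v : Tan x, 0 ≤ inner ℝ (radiiMap f x v) v) {M : ℝ} (hM0 : 0 ≤ M)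
    (hM : ∀ x, f x ≤ M) (x : Sph n) : ‖sphGrad f x‖ ≤ M := by
  by_cases h0 : sphGrad f x = 0
  · simpa [h0] using hM0
  have hn0 : ‖sphGrad f x‖ ≠ 0 := norm_ne_zero_iff.mpr h0
  set v : E n := ‖sphGrad f x‖⁻¹ • sphGrad f x with hv
  have hvn : ‖v‖ = 1 := norm_inv_norm_smul h0
  have hd : DifferentiableAt ℝ (radialExt f) (x : E n) :=
    (contDiffAt_radialExt hf (coe_ne_zero x)).differentiableAt (by simp)
  have hxv : inner ℝ (x : E n) v = 0 := by
    rw [hv, real_inner_smul_right, real_inner_comm, inner_sphGrad,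
      fderiv_radialExt_self f (coe_ne_zero x) hd, mul_zero]
  have h := great_circle_le hf hr x hvn hxv (b := Real.pi / 2) (by positivity)
    (by linarith [Real.pi_pos])
  have hdv : fderiv ℝ (radialExt f) (x : E n) v = ‖sphGrad f x‖ := by
    rw [← inner_sphGrad, hv, real_inner_smul_right, real_inner_self_eq_norm_sq]
    field_simp
  have hv0 : v ≠ 0 := fun h => by simp [h] at hvn
  rw [Real.cos_pi_div_two, Real.sin_pi_div_two, hdv, zero_smul, one_smul, zero_add, mul_zero,
    zero_add, mul_one, radialExt_of_ne f hv0] at h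
  exact h.trans (hM _)

/-- At a maximum the differential vanishes, so the tangent linear function along the great circle
from `e` to `y` is `f(e) cos θ`, where `θ` is the angle between them. The points `y = ±e`, where the
direction is undefined, are treated separately. -/
theorem mul_inner_le_of_isMax (hf : ContMDiff (𝓡 n) 𝓘(ℝ, ℝ) ∞ f)
    (hr : ∀ x, ∀ v : Tan x, 0 ≤ inner ℝ (radiiMap f x v) v) (hf0 : ∀ x, 0 ≤ f x) {e : Sph n}
    (he : ∀ x, f x ≤ f e) (y : Sph n) : f e * inner ℝ (y : E n) (e : E n) ≤ f y := by
  set c := inner ℝ (y : E n) (e : E n) with hc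
  have hcabs : |c| ≤ 1 := by
    simpa [norm_coe] using abs_real_inner_le_norm (y : E n) (e : E n)
  have hc1 : c ≤ 1 := (abs_le.mp hcabs).2
  have hc2 : -1 ≤ c := (abs_le.mp hcabs).1
  set w : E n := y - c • (e : E n) with hw
  have hee : inner ℝ (e : E n) (e : E n) = 1 := by
    rw [real_inner_self_eq_norm_sq, norm_coe, one_pow]
  have hyy : inner ℝ (y : E n) (y : E n) = 1 := by
    rw [real_inner_self_eq_norm_sq, norm_coe, one_pow]
  have hey : inner ℝ (e : E n) (y : E n) = c := by rw [real_inner_comm]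
  have hwn : ‖w‖ ^ 2 = 1 - c ^ 2 := by
    rw [← real_inner_self_eq_norm_sq, hw]
    simp only [inner_sub_left, inner_sub_right, real_inner_smul_left, real_inner_smul_right, hee,
      hyy, hey, ← hc]
    ring
  have hew : inner ℝ (e : E n) w = 0 := by
    rw [hw, inner_sub_right, real_inner_smul_right, hee, hey]
    ring
  by_cases hw0 : w = 0
  · have hye : (y : E n) = c • (e : E n) := sub_eq_zero.mp hw0
    have : c ^ 2 = 1 := by rw [hw0] at hwn; simp at hwn; linarith
    rcases sq_eq_one_iff.mp this with h | h
    · rw [h, one_smul] at hye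
      rw [h, mul_one, Subtype.ext hye]
    · rw [h]
      linarith [hf0 e, hf0 y]
  have hwn0 : ‖w‖ ≠ 0 := norm_ne_zero_iff.mpr hw0
  have hsin : Real.sin (Real.arccos c) = ‖w‖ := by
    rw [Real.sin_arccos, ← hwn, Real.sqrt_sq (norm_nonneg _)]
  have hmax : IsLocalMax (radialExt f) (e : E n) := by
    filter_upwards [isOpen_compl_singleton.mem_nhds (coe_ne_zero e)] with z hz
    rw [radialExt_coe, radialExt_of_ne f hz]
    exact he _
  have h := great_circle_le hf hr e (v := ‖w‖⁻¹ • w) (norm_inv_norm_smul hw0)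
    (by rw [real_inner_smul_right, hew, mul_zero]) (Real.arccos_nonneg c) (Real.arccos_le_pi c)
  rw [hmax.fderiv_eq_zero, Real.cos_arccos hc2 hc1, hsin, smul_smul, mul_inv_cancel₀ hwn0,
    one_smul, hw, add_sub_cancel, radialExt_coe] at h
  simpa using h

/-! ### The exponential barrier -/

theorem contMDiff_inner_coe (e : E n) :
    ContMDiff (𝓡 n) 𝓘(ℝ, ℝ) ∞ fun y : Sph n => inner ℝ (y : E n) e := by
  have := Fact.mk (@finrank_euclideanSpace_fin ℝ _ (n + 1))
  have h1 : ContMDiff (𝓡 n) 𝓘(ℝ, E n) ∞ (fun y : Sph n => (y : E n)) := contMDiff_coe_sphere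
  have h2 : ContDiff ℝ ∞ (fun y : E n => inner ℝ y e) := contDiff_id.inner ℝ contDiff_const
  exact h2.contMDiff.comp h1

/-- The barrier `y ↦ e^{L⟨y, e⟩}`. -/
noncomputable def expBarrier (L : ℝ) (e : E n) (y : Sph n) : ℝ := Real.exp (L * inner ℝ (y : E n) e)

theorem contMDiff_expBarrier (L : ℝ) (e : E n) :
    ContMDiff (𝓡 n) 𝓘(ℝ, ℝ) ∞ (expBarrier L e) := by
  have h2 : ContDiff ℝ ∞ (fun t : ℝ => Real.exp (L * t)) := by fun_prop
  exact h2.contMDiff.comp (contMDiff_inner_coe e)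

/-- Along `x + s u` the radial extension is the exponential of `L(⟨x,e⟩ + s⟨u,e⟩)/√(1 + s²‖u‖²)`,
whose second derivative at `0` is elementary. For large `L` the form is large somewhere unless `⟨x,
e⟩` is positive and not small, that is, unless `x` lies on the side of `e`. -/
theorem inner_radiiMap_expBarrier (L : ℝ) (e : E n) (x : Sph n) (u : Tan x) :
    inner ℝ (radiiMap (expBarrier L e) x u) u = expBarrier L e x *
      (L ^ 2 * inner ℝ (u : E n) e ^ 2 + (1 - L * inner ℝ (x : E n) e) * ‖u‖ ^ 2) := by
  set a := inner ℝ (x : E n) e with ha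
  set b := inner ℝ (u : E n) e with hb
  set c := ‖u‖ ^ 2 with hc
  have hc0 : 0 ≤ c := by positivity
  have hF := (contDiffAt_radialExt (contMDiff_expBarrier L e) (coe_ne_zero x)).of_le two_le_infty
  have hpos : ∀ s : ℝ, 0 < 1 + c * s ^ 2 := fun s => by positivity
  let q : ℝ → ℝ := fun s => (Real.sqrt (1 + c * s ^ 2))⁻¹
  let m : ℝ → ℝ := fun s => L * ((a + s * b) * q s)
  have hline : ∀ s : ℝ, radialExt (expBarrier L e) ((x : E n) + s • (u : E n)) =
      Real.exp (m s) := fun s => by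
    have hn : ‖(x : E n) + s • (u : E n)‖ = Real.sqrt (1 + c * s ^ 2) := by
      symm
      rw [Real.sqrt_eq_iff_mul_self_eq (hpos s).le (norm_nonneg _), ← pow_two, norm_add_sq_real,
        real_inner_smul_right, inner_coe_tan, norm_coe, norm_smul, mul_pow, Real.norm_eq_abs,
        sq_abs, hc, Submodule.coe_norm]
      ring
    have h0 : (x : E n) + s • (u : E n) ≠ 0 := by
      rw [← norm_ne_zero_iff, hn]
      exact (Real.sqrt_pos.mpr (hpos s)).ne'
    rw [radialExt_of_ne _ h0, expBarrier]
    simp only [radialProj, real_inner_smul_left, inner_add_left, m, q, hn, ← ha, ← hb]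
    congr 1
    ring
  have hq : ∀ s, HasDerivAt q (-(c * s) * q s ^ 3) s := fun s => by
    have h1 : HasDerivAt (fun s : ℝ => 1 + c * s ^ 2) (c * (2 * s)) s := by
      simpa using ((hasDerivAt_pow 2 s).const_mul c).const_add 1
    have h2 := (h1.sqrt (hpos s).ne').inv (Real.sqrt_pos.mpr (hpos s)).ne'
    refine h2.congr_deriv ?_
    have h3 := (Real.sqrt_pos.mpr (hpos s)).ne'
    simp only [q]
    field_simp
  have hlin : ∀ s : ℝ, HasDerivAt (fun s : ℝ => a + s * b) b s := fun s => by
    simpa using ((hasDerivAt_id s).mul_const b).const_add a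
  let m' : ℝ → ℝ := fun s => L * (b * q s + (a + s * b) * (-(c * s) * q s ^ 3))
  have hm : ∀ s, HasDerivAt m (m' s) s := fun s => ((hlin s).mul (hq s)).const_mul L
  have hq0 : q 0 = 1 := by simp [q]
  have hm' : HasDerivAt m' (-(L * a * c)) 0 := by
    have h1 : HasDerivAt (fun s : ℝ => -(c * s)) (-c) 0 := by
      simpa using ((hasDerivAt_id (0 : ℝ)).const_mul c).fun_neg
    have h2 := (((hq 0).const_mul b).add ((hlin 0).mul (h1.mul ((hq 0).pow 3)))).const_mul L
    refine h2.congr_deriv ?_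
    simp [hq0]
    ring
  have hm0 : m 0 = L * a := by simp [m, hq0]
  have hm'0 : m' 0 = L * b := by simp [m', hq0]
  have hdd : deriv (deriv fun s : ℝ => radialExt (expBarrier L e) ((x : E n) + s • (u : E n))) 0
      = Real.exp (L * a) * (L ^ 2 * b ^ 2 - L * a * c) := by
    have h1 : deriv (fun s : ℝ => radialExt (expBarrier L e) ((x : E n) + s • (u : E n))) =
        fun s => Real.exp (m s) * m' s := by
      ext s
      simp_rw [hline]
      exact (hm s).exp.deriv
    rw [h1, ((hm 0).exp.fun_mul hm').deriv, hm0, hm'0]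
    ring
  rw [inner_radiiMap, ← deriv_deriv_comp_line hF (u : E n), hdd, real_inner_self_eq_norm_sq,
    expBarrier, ← ha, ← Submodule.coe_norm, ← hc]
  ring

end SphereFlow

/-! ### Comparison of `σ_k` at touching points and the Harnack inequality -/

theorem LinearMap.exists_pos_mul_norm_sq_le {V : Type*} [NormedAddCommGroup V]
    [InnerProductSpace ℝ V] [FiniteDimensional ℝ V] {T : V →ₗ[ℝ] V}
    (hT : ∀ v, v ≠ 0 → 0 < inner ℝ (T v) v) :
    ∃ μ : ℝ, 0 < μ ∧ ∀ v, μ * ‖v‖ ^ 2 ≤ inner ℝ (T v) v := by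
  rcases subsingleton_or_nontrivial V with hV | hV
  · exact ⟨1, one_pos, fun v => by simp [Subsingleton.elim v 0]⟩
  have hcont : Continuous fun v : V => inner ℝ (T v) v :=
    (T.continuous_of_finiteDimensional).inner continuous_id
  obtain ⟨v₀, hv₀, hmin⟩ := (isCompact_sphere (0 : V) 1).exists_isMinOn
    (NormedSpace.sphere_nonempty.mpr zero_le_one) hcont.continuousOn
  refine ⟨inner ℝ (T v₀) v₀, hT v₀ (ne_zero_of_mem_unit_sphere ⟨v₀, hv₀⟩), fun v => ?_⟩
  by_cases hv : v = 0
  · simp [hv]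
  have hn : ‖v‖ ≠ 0 := norm_ne_zero_iff.mpr hv
  have h := hmin (a := ‖v‖⁻¹ • v) (by
    rw [mem_sphere_zero_iff_norm, norm_smul, norm_inv, norm_norm, inv_mul_cancel₀ hn])
  simp only [Set.mem_ofPred_eq, map_smul, real_inner_smul_left, real_inner_smul_right] at h
  calc inner ℝ (T v₀) v₀ * ‖v‖ ^ 2
      ≤ (‖v‖⁻¹ * (‖v‖⁻¹ * inner ℝ (T v) v)) * ‖v‖ ^ 2 := by gcongr
    _ = inner ℝ (T v) v := by field_simp

namespace SphereFlow

variable {n k : ℕ} {f g : Sph n → ℝ}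

theorem sigma_mul_choose (hkn : k ≤ n) (f : Sph n → ℝ) (x : Sph n) :
    (radiiMap f x).charpoly.roots.esymm k = sigma k f x * n.choose k := by
  have : (n.choose k : ℝ) ≠ 0 := by exact_mod_cast (Nat.choose_pos hkn).ne'
  rw [sigma, principalRadii]
  field_simp

theorem IsConvexSupport.nonneg (hf : IsConvexSupport f) (x : Sph n) (v : Tan x) :
    0 ≤ inner ℝ (radiiMap f x v) v := by
  by_cases hv : v = 0
  · simp [hv]
  · exact (hf.convex x v hv).le

theorem IsConvexSupport.isPositive (hf : IsConvexSupport f) (x : Sph n) :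
    (radiiMap f x).IsPositive :=
  ⟨radiiMap_isSymmetric hf.smooth x, hf.nonneg x⟩

theorem IsConvexSupport.sigma_pos (hf : IsConvexSupport f) (hk : 1 ≤ k) (hkn : k ≤ n)
    (x : Sph n) : 0 < sigma k f x := by
  obtain ⟨μ, hμ, hμT⟩ := LinearMap.exists_pos_mul_norm_sq_le (hf.convex x)
  have hkT : k ≤ Module.finrank ℝ (Tan x) := by rwa [finrank_tan]
  have : Nontrivial (Tan x) := Module.nontrivial_of_finrank_pos (R := ℝ) (by omega)
  obtain ⟨u, hu⟩ := exists_ne (0 : Tan x)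
  have h := (radiiMap_isSymmetric hf.smooth x).le_esymm hk hkT hμ hμT hu (hμT u)
  exact div_pos (lt_of_lt_of_le (by positivity) h) (by exact_mod_cast Nat.choose_pos hkn)

/-- Comparison of `σ_k` for a multiple of one radii tensor below another one. -/
theorem pow_mul_sigma_le (hkn : k ≤ n) {x : Sph n} {c : ℝ} (hc : 0 ≤ c)
    (hf : (radiiMap f x).IsPositive) (hg : (radiiMap g x).IsSymmetric)
    (hfg : ∀ v, c * inner ℝ (radiiMap f x v) v ≤ inner ℝ (radiiMap g x v) v) :
    c ^ k * sigma k f x ≤ sigma k g x := by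
  have hkT : k ≤ Module.finrank ℝ (Tan x) := by rwa [finrank_tan]
  have hch : (0 : ℝ) < n.choose k := by exact_mod_cast Nat.choose_pos hkn
  have h := (hf.smul_of_nonneg hc).esymm_le hg
    (fun v => by simpa [real_inner_smul_left] using hfg v) hkT
  rw [hf.1.esymm_smul c hkT, sigma_mul_choose hkn, sigma_mul_choose hkn, ← mul_assoc] at h
  exact le_of_mul_le_mul_right h hch

theorem sigma_const (hkn : k ≤ n) (c : ℝ) (x : Sph n) :
    sigma k (fun _ : Sph n => c) x = c ^ k := by
  have hkT : k ≤ Module.finrank ℝ (Tan x) := by rwa [finrank_tan]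
  have hch : (n.choose k : ℝ) ≠ 0 := by exact_mod_cast (Nat.choose_pos hkn).ne'
  rw [sigma, principalRadii, radiiMap_const, LinearMap.IsSymmetric.id.esymm_smul c hkT,
    LinearMap.esymm_id hkT, finrank_tan]
  field_simp

theorem isPositive_radiiMap_const {c : ℝ} (hc : 0 ≤ c) (x : Sph n) :
    (radiiMap (fun _ : Sph n => c) x).IsPositive := by
  rw [radiiMap_const]
  exact LinearMap.isPositive_id.smul_of_nonneg hc

theorem IsConvexSupport.sigma_le_of_isMax (hf : IsConvexSupport f) (hkn : k ≤ n) {x : Sph n}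
    (hx : ∀ y, f y ≤ f x) : sigma k f x ≤ f x ^ k := by
  have h := pow_mul_sigma_le (g := fun _ => f x) hkn zero_le_one (hf.isPositive x)
    (isPositive_radiiMap_const (hf.pos x).le x).1 fun v => by
      rw [one_mul]
      exact inner_radiiMap_le_of_touching hf.smooth contMDiff_const hx rfl v
  rwa [sigma_const hkn, one_pow, one_mul] at h

theorem IsConvexSupport.le_sigma_of_isMin (hf : IsConvexSupport f) (hkn : k ≤ n) {x : Sph n}
    (hx : ∀ y, f x ≤ f y) : f x ^ k ≤ sigma k f x := by
  have h := pow_mul_sigma_le (f := fun _ => f x) hkn zero_le_one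
    (isPositive_radiiMap_const (hf.pos x).le x) (hf.isPositive x).1 fun v => by
      rw [one_mul]
      exact inner_radiiMap_le_of_touching contMDiff_const hf.smooth hx rfl v
  rwa [sigma_const hkn, one_pow, one_mul] at h

/-- Harnack inequality: a convex support function with `σ_k ≤ C h^k` has bounded oscillation. -/
theorem exists_harnack (hk : 1 ≤ k) (hkn : k ≤ n) (C : ℝ) :
    ∃ θ : ℝ, 0 < θ ∧ ∀ f : Sph n → ℝ, IsConvexSupport f → (∀ x, sigma k f x ≤ C * f x ^ k) →
      ∀ x y, θ * f x ≤ f y := by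
  have hch : (0 : ℝ) < n.choose k := by exact_mod_cast Nat.choose_pos hkn
  -- Large enough that eigenvalues all at least `f/2`, one of them at least `f L/2`, violate `σ_k ≤
  -- C f^k`; the binomial coefficient undoes the normalization of `σ_k`.
  set L : ℝ := max 1 (2 ^ k * (n.choose k * C) + 1) with hL
  have hL1 : 1 ≤ L := le_max_left _ _
  have hL2 : 2 ^ k * (n.choose k * C) < L :=
    lt_of_lt_of_le (lt_add_one _) (le_max_right _ _)
  have hL0 : 0 < L := by linarith
  refine ⟨Real.exp (-(2 * L)) / (2 * L), by positivity, fun f hf hC x₀ y₀ => ?_⟩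
  have hcf : Continuous f := hf.smooth.continuous
  obtain ⟨e, -, he⟩ := isCompact_univ.exists_isMaxOn Set.univ_nonempty hcf.continuousOn
  replace he : ∀ y, f y ≤ f e := fun y => he (Set.mem_univ y)
  set v : Sph n → ℝ := expBarrier L (e : E n) with hv
  have hvpos : ∀ y, 0 < v y := fun y => Real.exp_pos _
  have hcv : Continuous v := (contMDiff_expBarrier L (e : E n)).continuous
  obtain ⟨x₁, -, hx₁⟩ := isCompact_univ.exists_isMinOn Set.univ_nonempty
    (hcf.div hcv fun y => (hvpos y).ne').continuousOn
  replace hx₁ : ∀ y, f x₁ / v x₁ ≤ f y / v y := fun y => hx₁ (Set.mem_univ y)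
  set m := f x₁ / v x₁ with hm
  have hmv : ∀ y, m * v y ≤ f y := fun y => (le_div_iff₀ (hvpos y)).mp (hx₁ y)
  have hmx : m * v x₁ = f x₁ := div_mul_cancel₀ _ (hvpos x₁).ne'
  set s := inner ℝ (x₁ : E n) (e : E n) with hs
  have hinner : ∀ y : Sph n, |inner ℝ (y : E n) (e : E n)| ≤ 1 := fun y => by
    simpa [norm_coe] using abs_real_inner_le_norm (y : E n) (e : E n)
  -- If the touching point lies on the side of `e`, then `f x₁ ≥ f e / (2L)`, and the barrier
  -- carries this to all points at the cost of a factor `e^{-2L}`. The other case is impossible.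
  by_cases hsL : 1 / (2 * L) ≤ s
  · have h1 : f e * (1 / (2 * L)) ≤ f x₁ :=
      (mul_le_mul_of_nonneg_left hsL (hf.pos e).le).trans
        (mul_inner_le_of_isMax hf.smooth hf.nonneg (fun y => (hf.pos y).le) he x₁)
    have h2 : Real.exp (-(2 * L)) * v x₁ ≤ v y₀ := by
      rw [hv, expBarrier, expBarrier, ← Real.exp_add, Real.exp_le_exp]
      have h3 := (abs_le.mp (hinner x₁)).2
      have h4 := (abs_le.mp (hinner y₀)).1
      nlinarith
    have hm0 : 0 ≤ m := (div_pos (hf.pos _) (hvpos _)).le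
    calc Real.exp (-(2 * L)) / (2 * L) * f x₀
        ≤ Real.exp (-(2 * L)) / (2 * L) * f e :=
          mul_le_mul_of_nonneg_left (he x₀) (by positivity)
      _ = Real.exp (-(2 * L)) * (f e * (1 / (2 * L))) := by ring
      _ ≤ Real.exp (-(2 * L)) * f x₁ := mul_le_mul_of_nonneg_left h1 (Real.exp_pos _).le
      _ = m * (Real.exp (-(2 * L)) * v x₁) := by rw [← hmx]; ring
      _ ≤ m * v y₀ := mul_le_mul_of_nonneg_left h2 hm0
      _ ≤ f y₀ := hmv y₀
  exfalso
  push Not at hsL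
  have hf1 := hf.pos x₁
  have hlow : ∀ u : Tan x₁, f x₁ * (L ^ 2 * inner ℝ (u : E n) (e : E n) ^ 2 +
      (1 - L * s) * ‖u‖ ^ 2) ≤ inner ℝ (radiiMap f x₁ u) u := fun u => by
    have h := inner_radiiMap_le_of_touching (f := fun y => m * v y) (x := x₁)
      (contMDiff_const.mul (contMDiff_expBarrier L (e : E n))) hf.smooth hmv hmx u
    rw [radiiMap_const_mul (contMDiff_expBarrier L (e : E n)), LinearMap.smul_apply,
      real_inner_smul_left, inner_radiiMap_expBarrier, ← mul_assoc, hmx] at h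
    exact h
  have hLs : L * s < 1 / 2 := by
    rw [lt_div_iff₀ (by positivity)] at hsL
    linarith
  have hα : ∀ u : Tan x₁, f x₁ / 2 * ‖u‖ ^ 2 ≤ inner ℝ (radiiMap f x₁ u) u := fun u => by
    refine le_trans ?_ (hlow u)
    have : 1 / 2 * ‖u‖ ^ 2 ≤ L ^ 2 * inner ℝ (u : E n) (e : E n) ^ 2 + (1 - L * s) * ‖u‖ ^ 2 := by
      nlinarith [sq_nonneg (L * inner ℝ (u : E n) (e : E n)), sq_nonneg ‖u‖]
    nlinarith
  have hkT : k ≤ Module.finrank ℝ (Tan x₁) := by rwa [finrank_tan]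
  have hu : ∃ u : Tan x₁, u ≠ 0 ∧ f x₁ * (L / 2) * ‖u‖ ^ 2 ≤ inner ℝ (radiiMap f x₁ u) u := by
    suffices ∃ u : Tan x₁, u ≠ 0 ∧ L / 2 * ‖u‖ ^ 2 ≤
        L ^ 2 * inner ℝ (u : E n) (e : E n) ^ 2 + (1 - L * s) * ‖u‖ ^ 2 by
      obtain ⟨u, hu0, hu⟩ := this
      exact ⟨u, hu0, le_trans (by rw [mul_assoc]; gcongr) (hlow u)⟩
    -- For `s ≤ -1/2` the isotropic coefficient `1 - L s` is already at least `L/2`, so any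
    -- direction works. Otherwise `|s| < 1/2`, and the tangential part of `e` makes the `L²` term
    -- dominate.
    by_cases hs2 : s ≤ -(1 / 2)
    · have : Nontrivial (Tan x₁) := Module.nontrivial_of_finrank_pos (R := ℝ) (by omega)
      obtain ⟨u, hu⟩ := exists_ne (0 : Tan x₁)
      refine ⟨u, hu, ?_⟩
      have h1 : L / 2 ≤ 1 - L * s := by nlinarith
      nlinarith [sq_nonneg (L * inner ℝ (u : E n) (e : E n)), sq_nonneg ‖u‖]
    · push Not at hs2
      have hs3 : s < 1 / 2 := by nlinarith
      have hxx : inner ℝ (x₁ : E n) (x₁ : E n) = 1 := by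
        rw [real_inner_self_eq_norm_sq, norm_coe, one_pow]
      have hee : inner ℝ (e : E n) (e : E n) = 1 := by
        rw [real_inner_self_eq_norm_sq, norm_coe, one_pow]
      have hex : inner ℝ (e : E n) (x₁ : E n) = s := real_inner_comm _ _
      let u : Tan x₁ := ⟨(e : E n) - s • (x₁ : E n), mem_tan_iff.mpr (by
        rw [inner_sub_right, real_inner_smul_right, hxx, ← hs]; ring)⟩
      have hue : inner ℝ (u : E n) (e : E n) = 1 - s ^ 2 := by
        simp only [u, inner_sub_left, real_inner_smul_left, hee, ← hs]
        ring
      have hun : ‖u‖ ^ 2 = 1 - s ^ 2 := by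
        rw [Submodule.coe_norm, ← real_inner_self_eq_norm_sq]
        simp only [u, inner_sub_left, inner_sub_right, real_inner_smul_left,
          real_inner_smul_right, hee, hxx, hex, ← hs]
        ring
      have hs4 : 3 / 4 < 1 - s ^ 2 := by nlinarith
      refine ⟨u, fun h => ?_, ?_⟩
      · rw [h, norm_zero] at hun
        norm_num at hun
        linarith
      · rw [hun, hue]
        have h1 : 3 / 4 * L ^ 2 ≤ L ^ 2 * (1 - s ^ 2) := by nlinarith [sq_nonneg L]
        have h2 : L / 2 ≤ 3 / 4 * L ^ 2 + (1 - L * s) := by nlinarith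
        calc L / 2 * (1 - s ^ 2) ≤ (L ^ 2 * (1 - s ^ 2) + (1 - L * s)) * (1 - s ^ 2) := by
              gcongr
              linarith
          _ = _ := by ring
  obtain ⟨u, hu0, hu⟩ := hu
  have h := (radiiMap_isSymmetric hf.smooth x₁).le_esymm hk hkT (half_pos hf1) hα hu0 hu
  rw [sigma_mul_choose hkn] at h
  have h2 : sigma k f x₁ * n.choose k ≤ (C * f x₁ ^ k) * n.choose k :=
    mul_le_mul_of_nonneg_right (hC x₁) hch.le
  have h3 : (f x₁ / 2) ^ (k - 1) * (f x₁ * (L / 2)) = f x₁ ^ k * L / 2 ^ k := by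
    obtain ⟨j, rfl⟩ : ∃ j, k = j + 1 := ⟨k - 1, by omega⟩
    rw [Nat.add_sub_cancel, div_pow, pow_succ, pow_succ]
    field_simp
  rw [h3] at h
  have h4 : f x₁ ^ k * L ≤ f x₁ ^ k * (2 ^ k * (n.choose k * C)) := by
    have h5 := h.trans h2
    rw [div_le_iff₀ (by positivity)] at h5
    linarith
  have h6 := le_of_mul_le_mul_left h4 (by positivity)
  linarith

end SphereFlow

/-! ### Spatial derivatives of time-dependent families -/

section Slices

variable {V X : Type*} [NormedAddCommGroup V] [NormedSpace ℝ V] [NormedAddCommGroup X]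
  [NormedSpace ℝ X]

/-- Time enters only as a parameter, so unique differentiability is needed on `U` alone and `I` may
be any set, in particular one with an endpoint at time zero. -/
theorem ContDiffOn.fderiv_slice {G : ℝ → V → X} {I : Set ℝ} {U : Set V} (hU : IsOpen U)
    (hG : ContDiffOn ℝ ∞ (fun q : ℝ × V => G q.1 q.2) (I ×ˢ U)) :
    ContDiffOn ℝ ∞ (fun q : ℝ × V => fderiv ℝ (G q.1) q.2) (I ×ˢ U) := by
  intro q hq
  have h1 : ContDiffWithinAt ℝ ∞ (Function.uncurry fun (q : ℝ × V) (y : V) => G q.1 y)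
      ((I ×ˢ U) ×ˢ U) (q, q.2) := by
    have h2 := hG q hq
    refine ContDiffWithinAt.comp (t := I ×ˢ U) (g := fun q : ℝ × V => G q.1 q.2)
      (f := fun r : (ℝ × V) × V => (r.1.1, r.2)) (q, q.2) h2 ?_ ?_
    · exact (contDiffWithinAt_fst.fst).prodMk contDiffWithinAt_snd
    · exact fun r hr => ⟨hr.1.1, hr.2⟩
  have h2 := h1.fderivWithin (m := ∞) (g := Prod.snd) contDiffWithinAt_snd hU.uniqueDiffOn
    (by simp) hq (fun r hr => hr.2)
  refine h2.congr_of_mem (fun r hr => ?_) hq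
  exact (fderivWithin_of_isOpen hU hr.2).symm

/-- Symmetry of the second derivative of the joint map, evaluated on the time direction and a
spatial direction. -/
theorem hasDerivAt_fderiv_slice {G : ℝ → V → X} {τ : ℝ} {x : V}
    (hG : ContDiffAt ℝ 2 (fun q : ℝ × V => G q.1 q.2) (τ, x)) :
    HasDerivAt (fun t => fderiv ℝ (G t) x) (fderiv ℝ (fun y => deriv (fun t => G t y) τ) x) τ := by
  set Γ : ℝ × V → X := fun q => G q.1 q.2 with hΓ
  have hd : ∀ᶠ q in nhds (τ, x), DifferentiableAt ℝ Γ q :=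
    (hG.eventually (by simp)).mono fun q hq => hq.differentiableAt (by norm_num)
  have hdd : DifferentiableAt ℝ (fderiv ℝ Γ) (τ, x) :=
    (hG.fderiv_right (m := 1) (by norm_num)).differentiableAt (by norm_num)
  have hmk1 : ∀ (t : ℝ) (y : V), HasDerivAt (fun t : ℝ => (t, y)) ((1 : ℝ), (0 : V)) t :=
    fun t y => (hasDerivAt_id t).prodMk (hasDerivAt_const t y)
  have hmk2 : ∀ (t : ℝ) (y : V), HasFDerivAt (fun y : V => (t, y))
      (ContinuousLinearMap.inr ℝ ℝ V) y := fun t y => hasFDerivAt_prodMk_right t y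
  have hy : ∀ᶠ t in nhds τ, fderiv ℝ (G t) x =
      (fderiv ℝ Γ (t, x)).comp (ContinuousLinearMap.inr ℝ ℝ V) := by
    have hc : Filter.Tendsto (fun t : ℝ => (t, x)) (nhds τ) (nhds (τ, x)) :=
      (hmk1 τ x).continuousAt
    filter_upwards [hc.eventually hd] with t ht
    exact (ht.hasFDerivAt.comp x (hmk2 t x)).fderiv
  have ht : ∀ᶠ y in nhds x, deriv (fun t => G t y) τ = fderiv ℝ Γ (τ, y) (1, 0) := by
    have hc : Filter.Tendsto (fun y : V => (τ, y)) (nhds x) (nhds (τ, x)) :=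
      (hmk2 τ x).continuousAt
    filter_upwards [hc.eventually hd] with y hy
    exact (hy.hasFDerivAt.comp_hasDerivAt τ (hmk1 τ y)).deriv
  have h1 : HasDerivAt (fun t => fderiv ℝ Γ (t, x)) (fderiv ℝ (fderiv ℝ Γ) (τ, x) (1, 0)) τ :=
    hdd.hasFDerivAt.comp_hasDerivAt τ (hmk1 τ x)
  have h2 : HasDerivAt (fun t => (fderiv ℝ Γ (t, x)).comp (ContinuousLinearMap.inr ℝ ℝ V))
      ((fderiv ℝ (fderiv ℝ Γ) (τ, x) (1, 0)).comp (ContinuousLinearMap.inr ℝ ℝ V)) τ := by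
    have := h1.clm_comp (hasDerivAt_const τ (ContinuousLinearMap.inr ℝ ℝ V))
    simpa using this
  have h3 : HasFDerivAt (fun y => fderiv ℝ Γ (τ, y) (1, 0))
      (((fderiv ℝ (fderiv ℝ Γ) (τ, x)).comp (ContinuousLinearMap.inr ℝ ℝ V)).flip (1, 0)) x := by
    have h4 : HasFDerivAt (fun y => fderiv ℝ Γ (τ, y))
        ((fderiv ℝ (fderiv ℝ Γ) (τ, x)).comp (ContinuousLinearMap.inr ℝ ℝ V)) x :=
      hdd.hasFDerivAt.comp x (hmk2 τ x)
    have := h4.clm_apply (hasFDerivAt_const ((1 : ℝ), (0 : V)) x)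
    simpa using this
  refine (h2.congr_of_eventuallyEq hy).congr_deriv ?_
  rw [Filter.EventuallyEq.fderiv_eq (f₁ := fun y => deriv (fun t => G t y) τ) ht, h3.fderiv]
  ext v
  exact (hG.isSymmSndFDerivAt (by simp)).eq _ _

end Slices

/-! ### Joint continuity of `σ_k` and the time derivative of the radii tensor -/

namespace SphereFlow

variable {n k : ℕ} {h : ℝ → Sph n → ℝ} {I : Set ℝ}

theorem contMDiff_of_contDiffOn_radialExt {f : Sph n → ℝ}
    (hf : ContDiffOn ℝ ∞ (radialExt f) {0}ᶜ) : ContMDiff (𝓡 n) 𝓘(ℝ, ℝ) ∞ f := by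
  have := Fact.mk (@finrank_euclideanSpace_fin ℝ _ (n + 1))
  have h1 : ContMDiff (𝓡 n) 𝓘(ℝ, E n) ∞ (fun y : Sph n => (y : E n)) := contMDiff_coe_sphere
  have h2 : ContMDiff (𝓡 n) 𝓘(ℝ, ℝ) ∞ (fun y : Sph n => radialExt f (y : E n)) :=
    (contMDiffOn_iff_contDiffOn.mpr hf).comp_contMDiff h1 fun y => coe_ne_zero y
  simpa using h2

/-- The tangent space moves with the point, so `r` is extended by zero to the ambient space and
written in one fixed basis. The matrix entries are then continuous, and `σ_k` is a normalized sum of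
minors. -/
theorem continuousOn_sigma (hkn : k ≤ n)
    (hh : ContMDiffOn (𝓘(ℝ, ℝ).prod (𝓡 n)) 𝓘(ℝ, ℝ) ∞
      (fun q : ℝ × Sph n => h q.1 q.2) (I ×ˢ Set.univ))
    (hs : ∀ τ ∈ I, ContMDiff (𝓡 n) 𝓘(ℝ, ℝ) ∞ (h τ)) :
    ContinuousOn (fun q : ℝ × Sph n => sigma k (h q.1) q.2) (I ×ˢ Set.univ) := by
  have hΦ := contDiffOn_radialExt_prod hh
  have hD1 := ContDiffOn.fderiv_slice (G := fun t => radialExt (h t)) isOpen_compl_singleton hΦ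
  have hD2 := ContDiffOn.fderiv_slice (G := fun t => fderiv ℝ (radialExt (h t)))
    isOpen_compl_singleton hD1
  have hc2 : ContinuousOn (fun q : ℝ × Sph n =>
      fderiv ℝ (fderiv ℝ (radialExt (h q.1))) (q.2 : E n)) (I ×ˢ Set.univ) :=
    hD2.continuousOn.comp (f := fun q : ℝ × Sph n => (q.1, (q.2 : E n))) (by fun_prop)
      fun q hq => ⟨hq.1, coe_ne_zero q.2⟩
  let b := EuclideanSpace.basisFun (Fin (n + 1)) ℝ
  let P : Sph n → E n → E n := fun x v => v - inner ℝ (x : E n) v • (x : E n)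
  have hP : ∀ (x : Sph n) (v : E n), ((Tan x).orthogonalProjectionOnto v : E n) = P x v := by
    intro x v
    have h1 := Submodule.starProjection_orthogonal_val (K := Submodule.span ℝ {(x : E n)}) (u := v)
    rw [Submodule.starProjection_unit_singleton ℝ (norm_coe x)] at h1
    exact h1
  let M : ℝ × Sph n → Matrix (Fin (n + 1)) (Fin (n + 1)) ℝ := fun q => Matrix.of fun i j =>
    fderiv ℝ (fderiv ℝ (radialExt (h q.1))) (q.2 : E n) (P q.2 (b j)) (P q.2 (b i)) +
      h q.1 q.2 * inner ℝ (P q.2 (b j)) (P q.2 (b i))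
  have hM : ContinuousOn M (I ×ˢ Set.univ) := by
    refine continuousOn_pi.mpr fun i => continuousOn_pi.mpr fun j => ?_
    have hPc : ∀ v, Continuous fun q : ℝ × Sph n => P q.2 v := fun v => by
      simp only [P]
      fun_prop
    exact ((hc2.clm_apply (hPc _).continuousOn).clm_apply (hPc _).continuousOn).add
      (hh.continuousOn.mul ((hPc _).inner (hPc _)).continuousOn)
  have hsig : ∀ q ∈ I ×ˢ (Set.univ : Set (Sph n)),
      sigma k (h q.1) q.2 = (M q).minorSum k / (n.choose k : ℝ) := by
    intro q hq
    have hkT : k ≤ Module.finrank ℝ (Tan q.2) := by rwa [finrank_tan]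
    rw [sigma, principalRadii, (radiiMap_isSymmetric (hs q.1 hq.1) q.2).esymm_eq_minorSum_extend
      hkT b.toBasis]
    congr 2
    ext i j
    rw [LinearMap.toMatrix_apply]
    have h1 : ∀ w : E n, b.toBasis.repr w i = inner ℝ (b i) w := fun w => by
      rw [OrthonormalBasis.coe_toBasis_repr_apply, OrthonormalBasis.repr_apply_apply]
    rw [h1]
    simp only [LinearMap.comp_apply, Submodule.subtype_apply, OrthonormalBasis.coe_toBasis,
      ContinuousLinearMap.coe_coe]
    rw [← Submodule.inner_orthogonalProjectionOnto_eq_of_mem_right, real_inner_comm,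
      inner_radiiMap, hP, hP]
    rfl
  exact (((Matrix.continuous_minorSum k).comp_continuousOn hM).div_const _).congr hsig

theorem continuous_sigma (hkn : k ≤ n) {f : Sph n → ℝ} (hf : ContMDiff (𝓡 n) 𝓘(ℝ, ℝ) ∞ f) :
    Continuous (sigma k f) := by
  have h1 := continuousOn_sigma (I := Set.univ) (h := fun _ => f) hkn
    (hf.comp contMDiff_snd).contMDiffOn fun _ _ => hf
  rw [Set.univ_prod_univ, continuousOn_univ] at h1
  exact h1.comp (f := fun x : Sph n => ((0 : ℝ), x)) (by fun_prop)

theorem radialExt_deriv (h : ℝ → Sph n → ℝ) (τ : ℝ) {y : E n} (hy : y ≠ 0) :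
    radialExt (fun x => deriv (fun t => h t x) τ) y = deriv (fun t => radialExt (h t) y) τ := by
  simp only [radialExt_of_ne _ hy]

theorem contMDiff_deriv {τ : ℝ} (hI : I ∈ nhds τ)
    (hh : ContMDiffOn (𝓘(ℝ, ℝ).prod (𝓡 n)) 𝓘(ℝ, ℝ) ∞
      (fun q : ℝ × Sph n => h q.1 q.2) (I ×ˢ Set.univ)) :
    ContMDiff (𝓡 n) 𝓘(ℝ, ℝ) ∞ fun x => deriv (fun t => h t x) τ := by
  refine contMDiff_of_contDiffOn_radialExt fun y hy => ContDiffAt.contDiffWithinAt ?_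
  have hU : ∀ᶠ z in nhds y, z ≠ (0 : E n) := isOpen_compl_singleton.mem_nhds hy
  have hΦ : ∀ z : E n, z ≠ 0 →
      ContDiffAt ℝ ∞ (fun q : ℝ × E n => radialExt (h q.1) q.2) (τ, z) := fun z hz =>
    (contDiffOn_radialExt_prod hh).contDiffAt
      (prod_mem_nhds hI (isOpen_compl_singleton.mem_nhds hz))
  have h1 : ContDiffAt ℝ ∞ (fun z : E n =>
      fderiv ℝ (fun q : ℝ × E n => radialExt (h q.1) q.2) (τ, z) (1, 0)) y := by
    have h2 : ContDiffAt ℝ ∞ (fun z : E n => (τ, z)) y := contDiffAt_const.prodMk contDiffAt_id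
    have h3 := ContDiffAt.comp y ((hΦ y hy).fderiv_right (m := ∞) (by simp)) h2
    exact h3.clm_apply contDiffAt_const
  refine h1.congr_of_eventuallyEq ?_
  filter_upwards [hU] with z hz
  rw [radialExt_deriv h τ hz]
  have h4 : HasDerivAt (fun t : ℝ => (t, z)) ((1 : ℝ), (0 : E n)) τ :=
    (hasDerivAt_id τ).prodMk (hasDerivAt_const τ z)
  exact (((hΦ z hz).differentiableAt (by simp)).hasFDerivAt.comp_hasDerivAt τ h4).deriv

/-- The time derivative commutes with the second spatial derivative. -/
theorem hasDerivAt_fderiv_fderiv_radialExt {τ : ℝ} (hI : I ∈ nhds τ)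
    (hh : ContMDiffOn (𝓘(ℝ, ℝ).prod (𝓡 n)) 𝓘(ℝ, ℝ) ∞
      (fun q : ℝ × Sph n => h q.1 q.2) (I ×ˢ Set.univ)) (x : Sph n) :
    HasDerivAt (fun t => fderiv ℝ (fderiv ℝ (radialExt (h t))) (x : E n))
      (fderiv ℝ (fderiv ℝ (radialExt fun y => deriv (fun t => h t y) τ)) (x : E n)) τ := by
  have hΦ := contDiffOn_radialExt_prod hh
  have hΦ1 := ContDiffOn.fderiv_slice (G := fun t => radialExt (h t)) isOpen_compl_singleton hΦ
  have hmem : ∀ z : E n, z ≠ 0 → I ×ˢ {0}ᶜ ∈ nhds (τ, z) := fun z hz =>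
    prod_mem_nhds hI (isOpen_compl_singleton.mem_nhds hz)
  have h1 := hasDerivAt_fderiv_slice (G := fun t y => fderiv ℝ (radialExt (h t)) y)
    ((hΦ1.contDiffAt (hmem x (coe_ne_zero x))).of_le two_le_infty)
  refine h1.congr_deriv (Filter.EventuallyEq.fderiv_eq ?_)
  filter_upwards [isOpen_compl_singleton.mem_nhds (coe_ne_zero x)] with y hy
  rw [(hasDerivAt_fderiv_slice (G := fun t => radialExt (h t))
    ((hΦ.contDiffAt (hmem y hy)).of_le two_le_infty)).deriv]
  refine Filter.EventuallyEq.fderiv_eq ?_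
  filter_upwards [isOpen_compl_singleton.mem_nhds hy] with z hz
  exact (radialExt_deriv h τ hz).symm

end SphereFlow

/-! ### Backward difference estimates for the radii tensor and `σ_k` -/

namespace SphereFlow

variable {n k : ℕ} {h : ℝ → Sph n → ℝ} {I : Set ℝ}

theorem hasDerivAt_of_contMDiffOn {τ : ℝ} (hI : I ∈ nhds τ)
    (hh : ContMDiffOn (𝓘(ℝ, ℝ).prod (𝓡 n)) 𝓘(ℝ, ℝ) ∞
      (fun q : ℝ × Sph n => h q.1 q.2) (I ×ˢ Set.univ)) (x : Sph n) :
    HasDerivAt (fun t => h t x) (deriv (fun t => h t x) τ) τ := by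
  have h1 : ContDiffAt ℝ ∞ (fun q : ℝ × E n => radialExt (h q.1) q.2) (τ, (x : E n)) :=
    (contDiffOn_radialExt_prod hh).contDiffAt
      (prod_mem_nhds hI (isOpen_compl_singleton.mem_nhds (coe_ne_zero x)))
  have h2 : HasDerivAt (fun t : ℝ => (t, (x : E n))) ((1 : ℝ), (0 : E n)) τ :=
    (hasDerivAt_id τ).prodMk (hasDerivAt_const τ _)
  have h3 := (h1.differentiableAt (by simp)).hasFDerivAt.comp_hasDerivAt τ h2
  have h4 : (fun q : ℝ × E n => radialExt (h q.1) q.2) ∘ (fun t : ℝ => (t, (x : E n))) =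
      fun t => h t x := by
    ext t
    exact radialExt_coe (h t) x
  rw [h4] at h3
  exact h3.differentiableAt.hasDerivAt

theorem tendsto_const_sub_nhdsGT (τ : ℝ) :
    Filter.Tendsto (fun s : ℝ => τ - s) (nhdsWithin 0 (Set.Ioi 0)) (nhds τ) := by
  have : Filter.Tendsto (fun s : ℝ => τ - s) (nhds 0) (nhds (τ - 0)) :=
    (continuous_const.sub continuous_id).tendsto 0
  rw [sub_zero] at this
  exact this.mono_left nhdsWithin_le_nhds

theorem eventually_norm_backward_le {X : Type*} [NormedAddCommGroup X] [NormedSpace ℝ X]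
    {B : ℝ → X} {B' : X} {τ : ℝ} (hB : HasDerivAt B B' τ) {κ : ℝ} (hκ : 0 < κ) :
    ∀ᶠ s in nhdsWithin (0 : ℝ) (Set.Ioi 0), ‖B (τ - s) - B τ + s • B'‖ ≤ κ * s := by
  filter_upwards [(tendsto_const_sub_nhdsGT τ).eventually
    ((hasDerivAt_iff_isLittleO.mp hB).def hκ), self_mem_nhdsWithin] with s hs hs0
  have hs0' : 0 < s := hs0
  rwa [show τ - s - τ = -s by ring, norm_neg, Real.norm_of_nonneg hs0'.le, neg_smul,
    sub_neg_eq_add] at hs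

theorem eventually_abs_quadratic_backward_le {V : Type*} [NormedAddCommGroup V] [NormedSpace ℝ V]
    {B : ℝ → V →L[ℝ] V →L[ℝ] ℝ} {B' : V →L[ℝ] V →L[ℝ] ℝ} {τ : ℝ} (hB : HasDerivAt B B' τ)
    {κ : ℝ} (hκ : 0 < κ) :
    ∀ᶠ s in nhdsWithin (0 : ℝ) (Set.Ioi 0), ∀ v : V,
      |B (τ - s) v v - B τ v v + s * B' v v| ≤ κ * s * ‖v‖ ^ 2 := by
  filter_upwards [eventually_norm_backward_le (X := V →L[ℝ] V →L[ℝ] ℝ) hB hκ] with s hs v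
  have h1 : B (τ - s) v v - B τ v v + s * B' v v = (B (τ - s) - B τ + s • B') v v := rfl
  rw [h1, ← Real.norm_eq_abs]
  calc ‖(B (τ - s) - B τ + s • B') v v‖ ≤ ‖B (τ - s) - B τ + s • B'‖ * ‖v‖ * ‖v‖ :=
        ContinuousLinearMap.le_opNorm₂ _ _ _
    _ ≤ κ * s * ‖v‖ * ‖v‖ := by gcongr
    _ = κ * s * ‖v‖ ^ 2 := by ring

/-- First-order expansion backward in time, uniform in the direction `v`. Positive definiteness
turns the `o(s)‖v‖²` error into a multiple of `r` itself; half of it pays for the Hessian and half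
for the term `h ḡ`. -/
theorem eventually_abs_inner_radiiMap_sub_le {τ : ℝ} (hI : I ∈ nhds τ)
    (hh : ContMDiffOn (𝓘(ℝ, ℝ).prod (𝓡 n)) 𝓘(ℝ, ℝ) ∞
      (fun q : ℝ × Sph n => h q.1 q.2) (I ×ˢ Set.univ)) (hconv : IsConvexSupport (h τ))
    (x : Sph n) {ε : ℝ} (hε : 0 < ε) :
    ∀ᶠ s in nhdsWithin (0 : ℝ) (Set.Ioi 0), ∀ v : Tan x,
      |inner ℝ (radiiMap (h (τ - s)) x v) v - inner ℝ (radiiMap (h τ) x v) v +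
        s * inner ℝ (radiiMap (fun y => deriv (fun t => h t y) τ) x v) v| ≤
      ε * s * inner ℝ (radiiMap (h τ) x v) v := by
  obtain ⟨μ, hμ, hμr⟩ := LinearMap.exists_pos_mul_norm_sq_le (hconv.convex x)
  have hκ : 0 < ε * μ / 2 := by positivity
  filter_upwards [eventually_abs_quadratic_backward_le
      (hasDerivAt_fderiv_fderiv_radialExt hI hh x) hκ,
    eventually_norm_backward_le (hasDerivAt_of_contMDiffOn hI hh x) hκ,
    self_mem_nhdsWithin] with s hs1 hs2 hs0 v
  have hs0' : 0 < s := hs0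
  have h1 := hs1 (v : E n)
  rw [Real.norm_eq_abs, smul_eq_mul] at hs2
  have h2 : |(h (τ - s) x - h τ x + s * deriv (fun t => h t x) τ) * ‖(v : E n)‖ ^ 2| ≤
      ε * μ / 2 * s * ‖(v : E n)‖ ^ 2 := by
    rw [abs_mul, abs_of_nonneg (sq_nonneg ‖(v : E n)‖)]
    gcongr
  have h3 := mul_le_mul_of_nonneg_left (hμr v) (mul_pos hε hs0').le
  rw [Submodule.coe_norm] at h3
  simp only [inner_radiiMap, real_inner_self_eq_norm_sq] at h3 ⊢
  rw [abs_le] at h1 h2 ⊢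
  constructor <;> linarith [h1.1, h1.2, h2.1, h2.2]

theorem eventually_nhdsGT_sub_mem {τ : ℝ} (hI : I ∈ nhds τ) :
    ∀ᶠ s in nhdsWithin (0 : ℝ) (Set.Ioi 0), τ - s ∈ I :=
  (tendsto_const_sub_nhdsGT τ).eventually hI

theorem eventually_nhdsGT_pos (c : ℝ) :
    ∀ᶠ s in nhdsWithin (0 : ℝ) (Set.Ioi 0), 0 < 1 - s * c := by
  have : Filter.Tendsto (fun s : ℝ => 1 - s * c) (nhds 0) (nhds (1 - 0 * c)) :=
    (continuous_const.sub (continuous_id.mul continuous_const)).tendsto 0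
  rw [zero_mul, sub_zero] at this
  exact (this.mono_left nhdsWithin_le_nhds).eventually (lt_mem_nhds one_pos)

/-- Since `c h` touches `∂_τ h` from above at `x`, `r[∂_τ h] ≤ c r[h]` there. Going back by `s` thus
leaves at least `(1 - s(c + ε)) r[h]`, and `σ_k` is monotone and homogeneous of degree `k`. -/
theorem eventually_pow_mul_sigma_le (hkn : k ≤ n) {τ : ℝ} (hI : I ∈ nhds τ)
    (hh : ContMDiffOn (𝓘(ℝ, ℝ).prod (𝓡 n)) 𝓘(ℝ, ℝ) ∞
      (fun q : ℝ × Sph n => h q.1 q.2) (I ×ˢ Set.univ))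
    (hconv : ∀ t ∈ I, IsConvexSupport (h t)) {x : Sph n} {c : ℝ}
    (hle : ∀ y, deriv (fun t => h t y) τ ≤ c * h τ y)
    (heq : deriv (fun t => h t x) τ = c * h τ x) {ε : ℝ} (hε : 0 < ε) :
    ∀ᶠ s in nhdsWithin (0 : ℝ) (Set.Ioi 0),
      (1 - s * (c + ε)) ^ k * sigma k (h τ) x ≤ sigma k (h (τ - s)) x := by
  have hτ := hconv τ (mem_of_mem_nhds hI)
  filter_upwards [eventually_abs_inner_radiiMap_sub_le hI hh hτ x hε, eventually_nhdsGT_sub_mem hI,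
    eventually_nhdsGT_pos (c + ε), self_mem_nhdsWithin] with s hs hsI hspos hs0
  have hs0' : 0 < s := hs0
  refine pow_mul_sigma_le hkn hspos.le (hτ.isPositive x) ((hconv _ hsI).isPositive x).1 fun v => ?_
  have h1 := (abs_le.mp (hs v)).1
  have h2 := inner_radiiMap_le_of_touching (g := fun y => c * h τ y)
    (contMDiff_deriv hI hh) (contMDiff_const.mul hτ.smooth) hle heq v
  rw [radiiMap_const_mul hτ.smooth, LinearMap.smul_apply, real_inner_smul_left] at h2
  have h3 := mul_le_mul_of_nonneg_left h2 hs0'.le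
  linarith

theorem eventually_sigma_le_pow_mul (hkn : k ≤ n) {τ : ℝ} (hI : I ∈ nhds τ)
    (hh : ContMDiffOn (𝓘(ℝ, ℝ).prod (𝓡 n)) 𝓘(ℝ, ℝ) ∞
      (fun q : ℝ × Sph n => h q.1 q.2) (I ×ˢ Set.univ))
    (hconv : ∀ t ∈ I, IsConvexSupport (h t)) {x : Sph n} {c : ℝ}
    (hle : ∀ y, c * h τ y ≤ deriv (fun t => h t y) τ)
    (heq : c * h τ x = deriv (fun t => h t x) τ) {ε : ℝ} (hε : 0 < ε) :
    ∀ᶠ s in nhdsWithin (0 : ℝ) (Set.Ioi 0),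
      sigma k (h (τ - s)) x ≤ (1 - s * (c - ε)) ^ k * sigma k (h τ) x := by
  have hτ := hconv τ (mem_of_mem_nhds hI)
  filter_upwards [eventually_abs_inner_radiiMap_sub_le hI hh hτ x hε, eventually_nhdsGT_sub_mem hI,
    eventually_nhdsGT_pos (c - ε), self_mem_nhdsWithin] with s hs hsI hspos hs0
  have hs0' : 0 < s := hs0
  -- Here the earlier tensor is the smaller one, at most `(1 - s(c - ε))` times the later, so the
  -- comparison is applied with the inverse factor.
  have h0 := pow_mul_sigma_le hkn (inv_pos.mpr hspos).le ((hconv _ hsI).isPositive x)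
    (hτ.isPositive x).1 fun v => by
      have h1 := (abs_le.mp (hs v)).2
      have h2 := inner_radiiMap_le_of_touching (f := fun y => c * h τ y)
        (contMDiff_const.mul hτ.smooth) (contMDiff_deriv hI hh) hle heq v
      rw [radiiMap_const_mul hτ.smooth, LinearMap.smul_apply, real_inner_smul_left] at h2
      have h3 := mul_le_mul_of_nonneg_left h2 hs0'.le
      rw [inv_mul_le_iff₀ hspos]
      linarith
  rwa [inv_pow, inv_mul_le_iff₀ (pow_pos hspos k)] at h0

theorem HasDerivAt.nonpos_of_eventually_le {ψ : ℝ → ℝ} {ψ' : ℝ} (hψ : HasDerivAt ψ ψ' 0)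
    (hle : ∀ᶠ s in nhdsWithin (0 : ℝ) (Set.Ioi 0), ψ s ≤ ψ 0) : ψ' ≤ 0 := by
  have h1 : Filter.Tendsto (slope ψ 0) (nhdsWithin 0 (Set.Ioi 0)) (nhds ψ') :=
    (hasDerivAt_iff_tendsto_slope.mp hψ).mono_left
      (nhdsWithin_mono 0 fun s (hs : 0 < s) => hs.ne')
  refine le_of_tendsto h1 ?_
  filter_upwards [hle, self_mem_nhdsWithin] with s hs hs0
  have hs0' : 0 < s := hs0
  rw [slope_def_field, sub_zero]
  exact div_nonpos_of_nonpos_of_nonneg (by linarith) hs0'.le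

end SphereFlow

/-! ### The two-point maximum principle for the speed -/

namespace SphereFlow

variable {n k : ℕ} {h : ℝ → Sph n → ℝ} {I : Set ℝ} {p : ℝ}

theorem le_zero_of_forall_pos_le_mul {a : ℝ} {m : ℕ} (ha : ∀ ε : ℝ, 0 < ε → a ≤ m * ε) :
    a ≤ 0 := by
  by_contra! hpos
  have h1 := ha (a / (m + 1)) (by positivity)
  have h2 : (m : ℝ) * (a / (m + 1)) = a - a / (m + 1) := by field_simp; ring
  have h3 : 0 < a / ((m : ℝ) + 1) := by positivity
  linarith

theorem hasDerivAt_log_backward {τ c : ℝ} (hI : I ∈ nhds τ)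
    (hh : ContMDiffOn (𝓘(ℝ, ℝ).prod (𝓡 n)) 𝓘(ℝ, ℝ) ∞
      (fun q : ℝ × Sph n => h q.1 q.2) (I ×ˢ Set.univ)) {x : Sph n} (hpos : 0 < h τ x)
    (hc : deriv (fun t => h t x) τ = c * h τ x) :
    HasDerivAt (fun s => Real.log (h (τ - s) x)) (-c) 0 := by
  have h1 := hasDerivAt_of_contMDiffOn hI hh x
  rw [hc] at h1
  have h2 : HasDerivAt (fun t => Real.log (h t x)) c (τ - 0) := by
    rw [sub_zero]
    refine (h1.log hpos.ne').congr_deriv ?_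
    field_simp
  simpa using h2.comp_const_sub τ 0

theorem hasDerivAt_log_one_sub_mul (a : ℝ) :
    HasDerivAt (fun s : ℝ => Real.log (1 - s * a)) (-a) 0 := by
  have h1 : HasDerivAt (fun s : ℝ => 1 - s * a) (-a) 0 := by
    simpa using ((hasDerivAt_id (0 : ℝ)).mul_const a).const_sub 1
  simpa using h1.log (by simp)

/-- Replacing `σ_k` at time `τ - s` by its lower bound gives a function of `s` that is
differentiable at `0` and still at most its value there. Its one-sided derivative is nonpositive,
and `ε → 0` gives the claim. The factor `φ(x)` is constant in time and can be omitted. -/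
theorem growth_le_of_backward_max (hk : 1 ≤ k) (hkn : k ≤ n) {τ : ℝ} (hI : I ∈ nhds τ)
    (hh : ContMDiffOn (𝓘(ℝ, ℝ).prod (𝓡 n)) 𝓘(ℝ, ℝ) ∞
      (fun q : ℝ × Sph n => h q.1 q.2) (I ×ˢ Set.univ))
    (hconv : ∀ t ∈ I, IsConvexSupport (h t)) {x y : Sph n} {c d δ β : ℝ}
    (hle : ∀ z, deriv (fun t => h t z) τ ≤ c * h τ z)
    (hx : deriv (fun t => h t x) τ = c * h τ x) (hy : deriv (fun t => h t y) τ = d * h τ y)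
    (hmax : ∀ᶠ s in nhdsWithin (0 : ℝ) (Set.Ioi 0),
      (1 - p) * Real.log (h (τ - s) x) + Real.log (sigma k (h (τ - s)) x) +
          β * Real.log (h (τ - s) y) + δ * s ≤
        (1 - p) * Real.log (h τ x) + Real.log (sigma k (h τ) x) + β * Real.log (h τ y)) :
    (p - 1 - k) * c + δ ≤ β * d := by
  have hτ := hconv τ (mem_of_mem_nhds hI)
  suffices (p - 1 - k) * c + δ - β * d ≤ 0 by linarith
  refine le_zero_of_forall_pos_le_mul (m := k) fun ε hε => ?_
  have hψ : HasDerivAt (fun s => (1 - p) * Real.log (h (τ - s) x) +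
      k * Real.log (1 - s * (c + ε)) + β * Real.log (h (τ - s) y) + δ * s)
      ((1 - p) * -c + k * -(c + ε) + β * -d + δ) 0 := by
    have hlin : HasDerivAt (fun s : ℝ => δ * s) δ 0 := by
      simpa using (hasDerivAt_id (0 : ℝ)).const_mul δ
    exact ((((hasDerivAt_log_backward hI hh (hτ.pos x) hx).const_mul (1 - p)).add
      ((hasDerivAt_log_one_sub_mul (c + ε)).const_mul (k : ℝ))).add
      ((hasDerivAt_log_backward hI hh (hτ.pos y) hy).const_mul β)).add hlin
  have h1 := HasDerivAt.nonpos_of_eventually_le hψ (by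
    filter_upwards [hmax, eventually_pow_mul_sigma_le hkn hI hh hconv hle hx hε,
      eventually_nhdsGT_pos (c + ε)] with s hs hsig hpos
    have hσ := hτ.sigma_pos hk hkn x
    have h2 := Real.log_le_log (mul_pos (pow_pos hpos k) hσ) hsig
    rw [Real.log_mul (pow_pos hpos k).ne' hσ.ne', Real.log_pow] at h2
    simp only [sub_zero, zero_mul, Real.log_one, mul_zero, add_zero]
    linarith)
  linarith

theorem le_growth_of_backward_min (hk : 1 ≤ k) (hkn : k ≤ n) {τ : ℝ} (hI : I ∈ nhds τ)
    (hh : ContMDiffOn (𝓘(ℝ, ℝ).prod (𝓡 n)) 𝓘(ℝ, ℝ) ∞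
      (fun q : ℝ × Sph n => h q.1 q.2) (I ×ˢ Set.univ))
    (hconv : ∀ t ∈ I, IsConvexSupport (h t)) {x y : Sph n} {c d δ β : ℝ}
    (hle : ∀ z, c * h τ z ≤ deriv (fun t => h t z) τ)
    (hx : deriv (fun t => h t x) τ = c * h τ x) (hy : deriv (fun t => h t y) τ = d * h τ y)
    (hmin : ∀ᶠ s in nhdsWithin (0 : ℝ) (Set.Ioi 0),
      (1 - p) * Real.log (h τ x) + Real.log (sigma k (h τ) x) + β * Real.log (h τ y) ≤
      (1 - p) * Real.log (h (τ - s) x) + Real.log (sigma k (h (τ - s)) x) +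
          β * Real.log (h (τ - s) y) - δ * s) :
    β * d + δ ≤ (p - 1 - k) * c := by
  have hτ := hconv τ (mem_of_mem_nhds hI)
  suffices β * d + δ - (p - 1 - k) * c ≤ 0 by linarith
  refine le_zero_of_forall_pos_le_mul (m := k) fun ε hε => ?_
  have hψ : HasDerivAt (fun s => -((1 - p) * Real.log (h (τ - s) x) +
      k * Real.log (1 - s * (c - ε)) + β * Real.log (h (τ - s) y) - δ * s))
      (-((1 - p) * -c + k * -(c - ε) + β * -d - δ)) 0 := by
    have hlin : HasDerivAt (fun s : ℝ => δ * s) δ 0 := by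
      simpa using (hasDerivAt_id (0 : ℝ)).const_mul δ
    exact (((((hasDerivAt_log_backward hI hh (hτ.pos x) hx).const_mul (1 - p)).add
      ((hasDerivAt_log_one_sub_mul (c - ε)).const_mul (k : ℝ))).add
      ((hasDerivAt_log_backward hI hh (hτ.pos y) hy).const_mul β)).sub hlin).neg
  have h1 := HasDerivAt.nonpos_of_eventually_le hψ (by
    filter_upwards [hmin, eventually_sigma_le_pow_mul hkn hI hh hconv hle hx.symm hε,
      eventually_nhdsGT_pos (c - ε), eventually_nhdsGT_sub_mem hI] with s hs hsig hpos hsI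
    have hσ := hτ.sigma_pos hk hkn x
    have h2 := Real.log_le_log ((hconv _ hsI).sigma_pos hk hkn x) hsig
    rw [Real.log_mul (pow_pos hpos k).ne' hσ.ne', Real.log_pow] at h2
    simp only [sub_zero, zero_mul, Real.log_one, mul_zero, add_zero]
    linarith)
  linarith

theorem timeInterval_mem_nhds {T : EReal} {τ : ℝ} (hτ : τ ∈ timeInterval T) (hpos : 0 < τ) :
    timeInterval T ∈ nhds τ := by
  have h1 : IsOpen {t : ℝ | (t : EReal) < T} := isOpen_lt continuous_coe_real_ereal continuous_const
  filter_upwards [h1.mem_nhds hτ.2, lt_mem_nhds hpos] with _ ht ht0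
  exact ⟨ht0.le, ht⟩

theorem Icc_subset_timeInterval {T : EReal} {τ : ℝ} (hτ : τ ∈ timeInterval T) :
    Set.Icc 0 τ ⊆ timeInterval T := fun _ ht =>
  ⟨ht.1, lt_of_le_of_lt (EReal.coe_le_coe_iff.mpr ht.2) hτ.2⟩

/-- The speed `φ h^{1-p} σ_k`, which is `∂_τ log h` up to a function of `τ`. -/
noncomputable def speed (k : ℕ) (p : ℝ) (φ f : Sph n → ℝ) (x : Sph n) : ℝ :=
  φ x * f x ^ (1 - p) * sigma k f x

/-- The normalizing factor `∫ h σ_k / ∫ φ⁻¹`. -/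
noncomputable def normFactor (k : ℕ) (φ f : Sph n → ℝ) : ℝ :=
  sphIntegral (fun y => f y * sigma k f y) / sphIntegral (fun y => 1 / φ y)

variable {φ h₀ : Sph n → ℝ} {T : EReal}

theorem IsNormalizedFlow.deriv_eq (hfl : IsNormalizedFlow k p φ h₀ T h) {τ : ℝ}
    (hτ : τ ∈ timeInterval T) (hpos : 0 < τ) (x : Sph n) :
    deriv (fun t => h t x) τ = (speed k p φ (h τ) x - normFactor k φ (h τ)) * h τ x := by
  rw [((hfl.evolution τ hτ x).hasDerivAt (timeInterval_mem_nhds hτ hpos)).deriv]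
  have h1 : h τ x ^ (2 - p) = h τ x * h τ x ^ (1 - p) := by
    rw [show 2 - p = 1 + (1 - p) by ring, Real.rpow_add ((hfl.convex τ hτ).pos x), Real.rpow_one]
  rw [h1, speed, normFactor]
  ring

theorem IsConvexSupport.log_speed_mul {f : Sph n → ℝ} (hf : IsConvexSupport f) (hk : 1 ≤ k)
    (hkn : k ≤ n) (hφ : ∀ x, 0 < φ x) (β : ℝ) (x y : Sph n) :
    Real.log (speed k p φ f x * f y ^ β) =
      (1 - p) * Real.log (f x) + Real.log (sigma k f x) + β * Real.log (f y) +
        Real.log (φ x) := by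
  have h1 := hφ x
  have h2 := hf.pos x
  have h3 := hf.pos y
  have h4 := hf.sigma_pos hk hkn x
  rw [speed, Real.log_mul (by positivity) (by positivity), Real.log_mul (by positivity)
    (by positivity), Real.log_mul (by positivity) (by positivity), Real.log_rpow h2,
    Real.log_rpow h3]
  ring

theorem IsConvexSupport.speed_pos {f : Sph n → ℝ} (hf : IsConvexSupport f) (hk : 1 ≤ k)
    (hkn : k ≤ n) (hφ : ∀ x, 0 < φ x) (x : Sph n) : 0 < speed k p φ f x := by
  have h1 := hφ x
  have h2 := hf.pos x
  have h4 := hf.sigma_pos hk hkn x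
  unfold speed
  positivity

theorem IsNormalizedFlow.continuousOn_speed (hfl : IsNormalizedFlow k p φ h₀ T h) (hkn : k ≤ n)
    (hφ : Continuous φ) :
    ContinuousOn (fun q : ℝ × Sph n => speed k p φ (h q.1) q.2) (timeInterval T ×ˢ Set.univ) :=
  ((hφ.comp continuous_snd).continuousOn.mul (hfl.smooth.continuousOn.rpow_const fun q hq =>
    Or.inl ((hfl.convex q.1 hq.1).pos q.2).ne')).mul
    (continuousOn_sigma hkn hfl.smooth fun τ hτ => (hfl.convex τ hτ).smooth)

theorem IsNormalizedFlow.continuousOn_log_speed_mul (hfl : IsNormalizedFlow k p φ h₀ T h)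
    (hk : 1 ≤ k) (hkn : k ≤ n) (hφ : Continuous φ) (hφpos : ∀ x, 0 < φ x) (β : ℝ) :
    ContinuousOn (fun q : ℝ × Sph n × Sph n =>
      Real.log (speed k p φ (h q.1) q.2.1 * h q.1 q.2.2 ^ β))
      (timeInterval T ×ˢ Set.univ ×ˢ Set.univ) := by
  have h1 : ContinuousOn (fun q : ℝ × Sph n × Sph n => speed k p φ (h q.1) q.2.1)
      (timeInterval T ×ˢ Set.univ ×ˢ Set.univ) :=
    (hfl.continuousOn_speed hkn hφ).comp (f := fun q : ℝ × Sph n × Sph n => (q.1, q.2.1))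
      (by fun_prop) fun q hq => ⟨hq.1, trivial⟩
  have h2 : ContinuousOn (fun q : ℝ × Sph n × Sph n => h q.1 q.2.2)
      (timeInterval T ×ˢ Set.univ ×ˢ Set.univ) :=
    hfl.smooth.continuousOn.comp (f := fun q : ℝ × Sph n × Sph n => (q.1, q.2.2))
      (by fun_prop) fun q hq => ⟨hq.1, trivial⟩
  refine (h1.mul (h2.rpow_const fun q hq => Or.inl ((hfl.convex q.1 hq.1).pos _).ne')).log
    fun q hq => ?_
  have hc := hfl.convex q.1 hq.1
  exact (mul_pos (hc.speed_pos hk hkn hφpos _) (Real.rpow_pos_of_pos (hc.pos _) _)).ne'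

/-- With `x` and `y` independent, the maximum in `x` alone identifies the fastest growth rate of
`h`. A one-point version would mix the spatial derivatives of `Q` and of `h^β`. -/
theorem IsNormalizedFlow.speed_mul_le (hfl : IsNormalizedFlow k p φ h₀ T h) (hk : 1 ≤ k)
    (hkn : k ≤ n) (hp : (k : ℝ) + 1 ≤ p) (hφ : Continuous φ) (hφpos : ∀ x, 0 < φ x) {K : ℝ}
    (hK : ∀ x y, speed k p φ h₀ x * h₀ y ^ (p - 1 - k) ≤ K) {τ : ℝ}
    (hτ : τ ∈ timeInterval T) (x y : Sph n) :
    speed k p φ (h τ) x * h τ y ^ (p - 1 - k) ≤ K := by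
  set β := p - 1 - k with hβ
  have hβ0 : 0 ≤ β := by linarith
  set W : ℝ × Sph n × Sph n → ℝ := fun q =>
    Real.log (speed k p φ (h q.1) q.2.1 * h q.1 q.2.2 ^ β) with hW
  have hpos : ∀ t ∈ timeInterval T, ∀ x y, 0 < speed k p φ (h t) x * h t y ^ β :=
    fun t ht x y => mul_pos ((hfl.convex t ht).speed_pos hk hkn hφpos _)
      (Real.rpow_pos_of_pos ((hfl.convex t ht).pos _) _)
  have hKpos : 0 < K := by
    have h1 := hpos 0 (Icc_subset_timeInterval hτ ⟨le_rfl, hτ.1⟩) x y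
    rw [hfl.initial] at h1
    exact h1.trans_le (hK x y)
  suffices W (τ, x, y) ≤ Real.log K from (Real.log_le_log_iff (hpos τ hτ x y) hKpos).mp this
  refine le_of_forall_pos_le_add fun ε hε => ?_
  -- The penalty `δ t` makes the maximum strict in time and costs at most `ε` at time `τ`.
  set δ := ε / (τ + 1) with hδ
  have hτ0 : 0 ≤ τ := hτ.1
  have hδ0 : 0 < δ := by positivity
  have hδτ : δ * τ ≤ ε := by
    rw [hδ, div_mul_eq_mul_div, div_le_iff₀ (by positivity)]
    nlinarith
  have hsub := Icc_subset_timeInterval hτ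
  have hcont : ContinuousOn (fun q => W q - δ * q.1) (Set.Icc 0 τ ×ˢ Set.univ ×ˢ Set.univ) :=
    ((hfl.continuousOn_log_speed_mul hk hkn hφ hφpos β).mono
      (Set.prod_mono_left hsub)).sub (by fun_prop)
  obtain ⟨⟨t, x', y'⟩, ⟨ht, -⟩, hmax⟩ := (isCompact_Icc.prod (isCompact_univ.prod
    isCompact_univ)).exists_isMaxOn ⟨(0, x, y), ⟨Set.left_mem_Icc.mpr hτ0, trivial, trivial⟩⟩ hcont
  replace hmax : ∀ s ∈ Set.Icc 0 τ, ∀ a b, W (s, a, b) - δ * s ≤ W (t, x', y') - δ * t :=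
    fun s hs a b => hmax (a := (s, a, b)) ⟨hs, trivial, trivial⟩
  have htI : t ∈ timeInterval T := hsub ht
  suffices hWt : W (t, x', y') ≤ Real.log K by
    have h1 := hmax τ (Set.right_mem_Icc.mpr hτ0) x y
    have h2 : 0 ≤ δ * t := mul_nonneg hδ0.le ht.1
    linarith
  refine Real.log_le_log (hpos t htI x' y') ?_
  rcases ht.1.eq_or_lt with h0 | ht0
  · rw [← h0, hfl.initial]
    exact hK x' y'
  have hct := hfl.convex t htI
  have hnhds := timeInterval_mem_nhds htI ht0
  have hspeed : ∀ z, speed k p φ (h t) z ≤ speed k p φ (h t) x' := fun z => by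
    have h1 : W (t, z, y') ≤ W (t, x', y') := by linarith [hmax t ht z y']
    have h2 := (Real.log_le_log_iff (hpos t htI _ _) (hpos t htI _ _)).mp h1
    exact le_of_mul_le_mul_right h2 (Real.rpow_pos_of_pos (hct.pos _) _)
  have key := growth_le_of_backward_max (p := p) (δ := δ) (β := β) (y := y') hk hkn hnhds
    hfl.smooth hfl.convex
    (fun z => by
      rw [hfl.deriv_eq htI ht0]
      exact mul_le_mul_of_nonneg_right (sub_le_sub_right (hspeed z) _) (hct.pos z).le)
    (hfl.deriv_eq htI ht0 x') (hfl.deriv_eq htI ht0 y') (by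
      filter_upwards [eventually_nhdsGT_sub_mem (Ioi_mem_nhds ht0),
        self_mem_nhdsWithin] with s hs hs0
      have hs0' : 0 < s := hs0
      have hs1 : t - s ∈ Set.Icc 0 τ := ⟨le_of_lt hs, by linarith [ht.2]⟩
      have h1 := hmax (t - s) hs1 x' y'
      simp only [hW] at h1
      rw [hct.log_speed_mul hk hkn hφpos,
        (hfl.convex _ (hsub hs1)).log_speed_mul hk hkn hφpos] at h1
      linarith)
  -- Contradiction: `key` says `β Q(x') + δ ≤ β Q(y')` once the normalizing factor cancels, while
  -- `Q(y') ≤ Q(x')`. Hence the maximum occurs at time zero.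
  have h2 := mul_le_mul_of_nonneg_left (hspeed y') hβ0
  rw [← hβ] at key
  linarith

theorem IsNormalizedFlow.le_speed_mul (hfl : IsNormalizedFlow k p φ h₀ T h) (hk : 1 ≤ k)
    (hkn : k ≤ n) (hp : (k : ℝ) + 1 ≤ p) (hφ : Continuous φ) (hφpos : ∀ x, 0 < φ x) {K : ℝ} (hKpos : 0 < K)
    (hK : ∀ x y, K ≤ speed k p φ h₀ x * h₀ y ^ (p - 1 - k)) {τ : ℝ}
    (hτ : τ ∈ timeInterval T) (x y : Sph n) :
    K ≤ speed k p φ (h τ) x * h τ y ^ (p - 1 - k) := by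
  set β := p - 1 - k with hβ
  have hβ0 : 0 ≤ β := by linarith
  set W : ℝ × Sph n × Sph n → ℝ := fun q =>
    Real.log (speed k p φ (h q.1) q.2.1 * h q.1 q.2.2 ^ β) with hW
  have hpos : ∀ t ∈ timeInterval T, ∀ x y, 0 < speed k p φ (h t) x * h t y ^ β :=
    fun t ht x y => mul_pos ((hfl.convex t ht).speed_pos hk hkn hφpos _)
      (Real.rpow_pos_of_pos ((hfl.convex t ht).pos _) _)
  suffices Real.log K ≤ W (τ, x, y) from (Real.log_le_log_iff hKpos (hpos τ hτ x y)).mp this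
  refine le_of_forall_pos_le_add fun ε hε => ?_
  set δ := ε / (τ + 1) with hδ
  have hτ0 : 0 ≤ τ := hτ.1
  have hδ0 : 0 < δ := by positivity
  have hδτ : δ * τ ≤ ε := by
    rw [hδ, div_mul_eq_mul_div, div_le_iff₀ (by positivity)]
    nlinarith
  have hsub := Icc_subset_timeInterval hτ
  have hcont : ContinuousOn (fun q => W q + δ * q.1) (Set.Icc 0 τ ×ˢ Set.univ ×ˢ Set.univ) :=
    ((hfl.continuousOn_log_speed_mul hk hkn hφ hφpos β).mono
      (Set.prod_mono_left hsub)).add (by fun_prop)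
  obtain ⟨⟨t, x', y'⟩, ⟨ht, -⟩, hmin⟩ := (isCompact_Icc.prod (isCompact_univ.prod
    isCompact_univ)).exists_isMinOn ⟨(0, x, y), ⟨Set.left_mem_Icc.mpr hτ0, trivial, trivial⟩⟩ hcont
  replace hmin : ∀ s ∈ Set.Icc 0 τ, ∀ a b, W (t, x', y') + δ * t ≤ W (s, a, b) + δ * s :=
    fun s hs a b => hmin (a := (s, a, b)) ⟨hs, trivial, trivial⟩
  have htI : t ∈ timeInterval T := hsub ht
  suffices hWt : Real.log K ≤ W (t, x', y') by
    have h1 := hmin τ (Set.right_mem_Icc.mpr hτ0) x y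
    have h2 : 0 ≤ δ * t := mul_nonneg hδ0.le ht.1
    linarith
  refine Real.log_le_log hKpos ?_
  rcases ht.1.eq_or_lt with h0 | ht0
  · rw [← h0, hfl.initial]
    exact hK x' y'
  have hct := hfl.convex t htI
  have hnhds := timeInterval_mem_nhds htI ht0
  have hspeed : ∀ z, speed k p φ (h t) x' ≤ speed k p φ (h t) z := fun z => by
    have h1 : W (t, x', y') ≤ W (t, z, y') := by linarith [hmin t ht z y']
    have h2 := (Real.log_le_log_iff (hpos t htI _ _) (hpos t htI _ _)).mp h1
    exact le_of_mul_le_mul_right h2 (Real.rpow_pos_of_pos (hct.pos _) _)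
  have key := le_growth_of_backward_min (p := p) (δ := δ) (β := β) (y := y') hk hkn hnhds
    hfl.smooth hfl.convex
    (fun z => by
      rw [hfl.deriv_eq htI ht0]
      exact mul_le_mul_of_nonneg_right (sub_le_sub_right (hspeed z) _) (hct.pos z).le)
    (hfl.deriv_eq htI ht0 x') (hfl.deriv_eq htI ht0 y') (by
      filter_upwards [eventually_nhdsGT_sub_mem (Ioi_mem_nhds ht0),
        self_mem_nhdsWithin] with s hs hs0
      have hs0' : 0 < s := hs0
      have hs1 : t - s ∈ Set.Icc 0 τ := ⟨le_of_lt hs, by linarith [ht.2]⟩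
      have h1 := hmin (t - s) hs1 x' y'
      simp only [hW] at h1
      rw [hct.log_speed_mul hk hkn hφpos,
        (hfl.convex _ (hsub hs1)).log_speed_mul hk hkn hφpos] at h1
      linarith)
  -- The same contradiction with inequalities reversed: `Q(x')` is now minimal.
  have h2 := mul_le_mul_of_nonneg_left (hspeed y') hβ0
  rw [← hβ] at key
  linarith

end SphereFlow

/-! ### A priori bounds along the flow -/

namespace SphereFlow

variable {n k : ℕ} {h : ℝ → Sph n → ℝ} {p : ℝ} {φ h₀ f : Sph n → ℝ} {T : EReal}

theorem sphGrad_log (hf : ContMDiff (𝓡 n) 𝓘(ℝ, ℝ) ∞ f) (hpos : ∀ x, 0 < f x) (x : Sph n) :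
    sphGrad (fun y => Real.log (f y)) x = (f x)⁻¹ • sphGrad f x := by
  refine ext_inner_right ℝ fun v => ?_
  have hd : DifferentiableAt ℝ (radialExt f) (x : E n) :=
    (contDiffAt_radialExt hf (coe_ne_zero x)).differentiableAt (by simp)
  have he : radialExt (fun y => Real.log (f y)) =ᶠ[nhds (x : E n)]
      fun y => Real.log (radialExt f y) := by
    filter_upwards [isOpen_compl_singleton.mem_nhds (coe_ne_zero x)] with y hy
    rw [radialExt_of_ne _ hy, radialExt_of_ne _ hy]
  rw [real_inner_smul_left, inner_sphGrad, inner_sphGrad, he.fderiv_eq,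
    fderiv.log hd (by rw [radialExt_coe]; exact (hpos x).ne'), radialExt_coe]
  rfl

theorem exists_forall_le_of_continuous {X : Type*} [TopologicalSpace X] [CompactSpace X]
    {g : X → ℝ} (hg : Continuous g) (hpos : ∀ x, 0 < g x) :
    ∃ a b : ℝ, 0 < a ∧ 0 < b ∧ ∀ x, a ≤ g x ∧ g x ≤ b := by
  rcases isEmpty_or_nonempty X with hX | hX
  · exact ⟨1, 1, one_pos, one_pos, fun x => hX.elim x⟩
  obtain ⟨x, -, hx⟩ := isCompact_univ.exists_isMinOn Set.univ_nonempty hg.continuousOn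
  obtain ⟨y, -, hy⟩ := isCompact_univ.exists_isMaxOn Set.univ_nonempty hg.continuousOn
  exact ⟨g x, g y, hpos x, hpos y, fun z => ⟨hx (Set.mem_univ z), hy (Set.mem_univ z)⟩⟩

theorem IsConvexSupport.speed_mul_rpow_self (hf : IsConvexSupport f) (x : Sph n) :
    speed k p φ f x * f x ^ (p - 1 - k) * f x ^ k = φ x * sigma k f x := by
  have h1 := hf.pos x
  have h2 : f x ^ (1 - p) * f x ^ (p - 1 - k) * f x ^ k = 1 := by
    rw [← Real.rpow_natCast, ← Real.rpow_add h1, ← Real.rpow_add h1,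
      show 1 - p + (p - 1 - k) + k = 0 by ring, Real.rpow_zero]
  calc speed k p φ f x * f x ^ (p - 1 - k) * f x ^ k
      = φ x * sigma k f x * (f x ^ (1 - p) * f x ^ (p - 1 - k) * f x ^ k) := by
        unfold speed; ring
    _ = φ x * sigma k f x := by rw [h2, mul_one]

/-- `σ_k(h) / h^k` is bounded above and below along the flow. -/
theorem exists_sigma_pinching (hk : 1 ≤ k) (hkn : k ≤ n) (hp : (k : ℝ) + 1 ≤ p)
    (hφ : Continuous φ) (hφpos : ∀ x, 0 < φ x) (hh₀ : IsConvexSupport h₀) :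
    ∃ c C : ℝ, 0 < c ∧ 0 < C ∧ ∀ (T : EReal) (h : ℝ → Sph n → ℝ),
      IsNormalizedFlow k p φ h₀ T h → ∀ τ ∈ timeInterval T, ∀ x,
        c * h τ x ^ k ≤ sigma k (h τ) x ∧ sigma k (h τ) x ≤ C * h τ x ^ k := by
  obtain ⟨m, M, hm, hM, hmM⟩ := exists_forall_le_of_continuous hφ hφpos
  have hspeed : Continuous (speed k p φ h₀) :=
    (hφ.mul (hh₀.smooth.continuous.rpow_const fun x => Or.inl (hh₀.pos x).ne')).mul
      (continuous_sigma hkn hh₀.smooth)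
  obtain ⟨K₁, K₂, hK₁, hK₂, hK⟩ := exists_forall_le_of_continuous
    (g := fun q : Sph n × Sph n => speed k p φ h₀ q.1 * h₀ q.2 ^ (p - 1 - k))
    ((hspeed.comp continuous_fst).mul ((hh₀.smooth.continuous.comp continuous_snd).rpow_const
      fun q => Or.inl (hh₀.pos _).ne'))
    fun q => mul_pos (hh₀.speed_pos hk hkn hφpos _) (Real.rpow_pos_of_pos (hh₀.pos _) _)
  -- The two-point bounds are used on the diagonal, where the quantity is `φ σ_k / h^k`; dividing by
  -- the bounds of `φ` gives the constants.
  refine ⟨K₁ / M, K₂ / m, by positivity, by positivity, fun T h hfl τ hτ x => ?_⟩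
  have hc := hfl.convex τ hτ
  have h1 := hfl.le_speed_mul hk hkn hp hφ hφpos hK₁ (fun x y => (hK (x, y)).1) hτ x x
  have h2 := hfl.speed_mul_le hk hkn hp hφ hφpos (fun x y => (hK (x, y)).2) hτ x x
  have hpow := pow_pos (hc.pos x) k
  have h3 := mul_le_mul_of_nonneg_right h1 hpow.le
  have h4 := mul_le_mul_of_nonneg_right h2 hpow.le
  rw [hc.speed_mul_rpow_self] at h3 h4
  have hσ := hc.sigma_pos hk hkn x
  constructor
  · rw [div_mul_eq_mul_div, div_le_iff₀ hM]
    nlinarith [(hmM x).2]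
  · rw [div_mul_eq_mul_div, le_div_iff₀ hm]
    nlinarith [(hmM x).1]

theorem integrable_of_continuous {g : Sph n → ℝ} (hg : Continuous g) :
    Integrable g ((volume : Measure (E n)).toSphere) :=
  hg.integrable_of_hasCompactSupport (HasCompactSupport.of_compactSpace g)

theorem sphIntegral_mono {g₁ g₂ : Sph n → ℝ} (h₁ : Continuous g₁) (h₂ : Continuous g₂)
    (hle : ∀ x, g₁ x ≤ g₂ x) : sphIntegral g₁ ≤ sphIntegral g₂ :=
  integral_mono (integrable_of_continuous h₁) (integrable_of_continuous h₂) hle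

theorem sphIntegral_const (c : ℝ) :
    sphIntegral (fun _ : Sph n => c) = (volume : Measure (E n)).toSphere.real Set.univ * c := by
  rw [sphIntegral, integral_const, smul_eq_mul]

theorem toSphere_real_univ_pos : 0 < (volume : Measure (E n)).toSphere.real Set.univ :=
  ENNReal.toReal_pos (isOpen_univ.measure_pos _ Set.univ_nonempty).ne' (measure_ne_top _ _)

/-- Two-sided bounds for the support function along the flow. -/
theorem exists_support_bounds (hk : 1 ≤ k) (hkn : k ≤ n) (hp : (k : ℝ) + 1 ≤ p)
    (hφ : Continuous φ) (hφpos : ∀ x, 0 < φ x) (hh₀ : IsConvexSupport h₀) :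
    ∃ a b : ℝ, 0 < a ∧ 0 < b ∧ ∀ (T : EReal) (h : ℝ → Sph n → ℝ),
      IsNormalizedFlow k p φ h₀ T h → ∀ τ ∈ timeInterval T, ∀ x,
        a ≤ h τ x ∧ h τ x ≤ b := by
  obtain ⟨c₁, C₁, hc₁, hC₁, hpinch⟩ := exists_sigma_pinching hk hkn hp hφ hφpos hh₀
  obtain ⟨θ, hθ, hharnack⟩ := exists_harnack (n := n) hk hkn C₁
  obtain ⟨m, M, hm, hM, hmM⟩ := exists_forall_le_of_continuous hφ hφpos
  obtain ⟨a₀, b₀, ha₀, hb₀, hab₀⟩ := exists_forall_le_of_continuous hh₀.smooth.continuous hh₀.pos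
  have hp0 : 0 < p := lt_of_lt_of_le (by positivity) hp
  set A : ℝ := (volume : Measure (E n)).toSphere.real Set.univ with hA
  have hApos : 0 < A := toSphere_real_univ_pos
  set J : ℝ := sphIntegral (fun y => 1 / φ y) with hJ
  have hφinv : Continuous fun y => 1 / φ y := continuous_const.div hφ fun y => (hφpos y).ne'
  have hJpos : 0 < J := by
    have h1 := sphIntegral_mono continuous_const hφinv (g₁ := fun _ => 1 / M) fun x =>
      one_div_le_one_div_of_le (hφpos x) (hmM x).2
    rw [sphIntegral_const] at h1
    exact lt_of_lt_of_le (by positivity) h1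
  -- Pinching makes `h σ_k` comparable to `h^{k+1}`, and the Harnack inequality replaces its average
  -- over the sphere by the value at any one point, at the cost of `θ^{±(k+1)}`.
  set c₂ : ℝ := A * (c₁ * θ ^ (k + 1)) / J with hc₂
  set C₂ : ℝ := A * (C₁ * θ⁻¹ ^ (k + 1)) / J with hC₂
  have hc₂pos : 0 < c₂ := by positivity
  have hC₂pos : 0 < C₂ := by positivity
  have hnorm : ∀ (T : EReal) (h : ℝ → Sph n → ℝ), IsNormalizedFlow k p φ h₀ T h →
      ∀ τ ∈ timeInterval T, ∀ x, c₂ * h τ x ^ (k + 1) ≤ normFactor k φ (h τ) ∧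
        normFactor k φ (h τ) ≤ C₂ * h τ x ^ (k + 1) := by
    intro T h hfl τ hτ x
    have hc := hfl.convex τ hτ
    have hH := hharnack (h τ) hc fun y => (hpinch T h hfl τ hτ y).2
    have hx := hc.pos x
    have hcont : Continuous fun y => h τ y * sigma k (h τ) y :=
      hc.smooth.continuous.mul (continuous_sigma hkn hc.smooth)
    have h1 := sphIntegral_mono (g₁ := fun _ => c₁ * θ ^ (k + 1) * h τ x ^ (k + 1))
      continuous_const hcont fun y => by
        have hy := hc.pos y
        calc c₁ * θ ^ (k + 1) * h τ x ^ (k + 1) = c₁ * (θ * h τ x) ^ (k + 1) := by ring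
          _ ≤ c₁ * h τ y ^ (k + 1) := by
            have := hH x y
            gcongr
          _ = h τ y * (c₁ * h τ y ^ k) := by ring
          _ ≤ h τ y * sigma k (h τ) y := by
            have := (hpinch T h hfl τ hτ y).1
            gcongr
    have h2 := sphIntegral_mono (g₂ := fun _ => C₁ * θ⁻¹ ^ (k + 1) * h τ x ^ (k + 1)) hcont
      continuous_const fun y => by
        have hy := hc.pos y
        calc h τ y * sigma k (h τ) y ≤ h τ y * (C₁ * h τ y ^ k) := by
              have := (hpinch T h hfl τ hτ y).2
              gcongr
          _ = C₁ * h τ y ^ (k + 1) := by ring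
          _ ≤ C₁ * (θ⁻¹ * h τ x) ^ (k + 1) := by
              have : h τ y ≤ θ⁻¹ * h τ x := (le_inv_mul_iff₀ hθ).mpr (hH y x)
              gcongr
          _ = C₁ * θ⁻¹ ^ (k + 1) * h τ x ^ (k + 1) := by ring
    rw [sphIntegral_const, ← hA] at h1 h2
    rw [normFactor, ← hJ, hc₂, hC₂]
    constructor
    · rw [div_mul_eq_mul_div, div_le_div_iff_of_pos_right hJpos]
      linarith
    · rw [div_mul_eq_mul_div, div_le_div_iff_of_pos_right hJpos]
      linarith
  -- Either the extremum is at time zero, or the balance `φ h^{1-p+k}` against `h^{k+1}` at the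
  -- extremal point bounds `h^p` by `m / C₂` from below, respectively by `M / c₂` from above.
  refine ⟨min a₀ ((m / C₂) ^ p⁻¹), max b₀ ((M / c₂) ^ p⁻¹), by positivity, by positivity,
    fun T h hfl τ hτ x => ?_⟩
  have hsub := Icc_subset_timeInterval hτ
  have hcont : ContinuousOn (fun q : ℝ × Sph n => h q.1 q.2) (Set.Icc 0 τ ×ˢ Set.univ) :=
    hfl.smooth.continuousOn.mono (Set.prod_mono_left hsub)
  have hτ0 : (0 : ℝ) ≤ τ := hτ.1
  have hne : (Set.Icc 0 τ ×ˢ (Set.univ : Set (Sph n))).Nonempty :=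
    ⟨(0, x), ⟨Set.left_mem_Icc.mpr hτ0, trivial⟩⟩
  have hrpow : ∀ y : ℝ, 0 < y → y ^ (1 - p) * y ^ k * y ^ p = y ^ (k + 1) := fun y hy => by
    rw [← Real.rpow_natCast, ← Real.rpow_natCast, ← Real.rpow_add hy, ← Real.rpow_add hy]
    congr 1
    push_cast
    ring
  constructor
  · obtain ⟨⟨t, y⟩, ⟨ht, -⟩, hmin⟩ := (isCompact_Icc.prod isCompact_univ).exists_isMinOn hne hcont
    replace ht : t ∈ Set.Icc 0 τ := ht
    replace hmin : ∀ s ∈ Set.Icc 0 τ, ∀ z, h t y ≤ h s z := fun s hs z =>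
      hmin (a := (s, z)) ⟨hs, trivial⟩
    refine le_trans ?_ (hmin τ (Set.right_mem_Icc.mpr hτ0) x)
    rcases ht.1.eq_or_lt with h0 | ht0
    · rw [← h0, hfl.initial]
      exact (min_le_left _ _).trans (hab₀ y).1
    have htI := hsub ht
    have hct := hfl.convex t htI
    have hy := hct.pos y
    have hnhds := timeInterval_mem_nhds htI ht0
    -- At a minimum over `[0, τ]` earlier values are no smaller, so the growth rate is nonpositive
    -- and `Q ≤ η`.
    have h1 := HasDerivAt.nonpos_of_eventually_le
      (hasDerivAt_log_backward hnhds hfl.smooth hy (hfl.deriv_eq htI ht0 y)).neg (by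
        filter_upwards [eventually_nhdsGT_sub_mem (Ioi_mem_nhds ht0), self_mem_nhdsWithin]
          with s hs hs0
        have hs0' : 0 < s := hs0
        have h2 := Real.log_le_log hy (hmin (t - s) ⟨le_of_lt hs, by linarith [ht.2]⟩ y)
        simpa using h2)
    have h2 : m * (h t y ^ (1 - p) * h t y ^ k) ≤ speed k p φ (h t) y := by
      have h3 := hct.le_sigma_of_isMin hkn (hmin t ht)
      have hφy := hφpos y
      have h4 := (hmM y).1
      rw [← mul_assoc, speed]
      gcongr
    have h3 := (hnorm T h hfl t htI y).2
    have h4 : m * (h t y ^ (1 - p) * h t y ^ k) ≤ C₂ * h t y ^ (k + 1) := by linarith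
    rw [← hrpow _ hy] at h4
    have h5 : 0 < h t y ^ (1 - p) * h t y ^ k := by positivity
    have h6 : m ≤ C₂ * h t y ^ p := by
      refine le_of_mul_le_mul_right (h4.trans_eq ?_) h5
      ring
    refine (min_le_right _ _).trans ?_
    rw [Real.rpow_inv_le_iff_of_pos (by positivity) hy.le hp0, div_le_iff₀ hC₂pos]
    linarith
  · obtain ⟨⟨t, y⟩, ⟨ht, -⟩, hmax⟩ := (isCompact_Icc.prod isCompact_univ).exists_isMaxOn hne hcont
    replace ht : t ∈ Set.Icc 0 τ := ht
    replace hmax : ∀ s ∈ Set.Icc 0 τ, ∀ z, h s z ≤ h t y := fun s hs z =>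
      hmax (a := (s, z)) ⟨hs, trivial⟩
    refine (hmax τ (Set.right_mem_Icc.mpr hτ0) x).trans ?_
    rcases ht.1.eq_or_lt with h0 | ht0
    · rw [← h0, hfl.initial]
      exact (hab₀ y).2.trans (le_max_left _ _)
    have htI := hsub ht
    have hct := hfl.convex t htI
    have hy := hct.pos y
    have hnhds := timeInterval_mem_nhds htI ht0
    have h1 := HasDerivAt.nonpos_of_eventually_le
      (hasDerivAt_log_backward hnhds hfl.smooth hy (hfl.deriv_eq htI ht0 y)) (by
        filter_upwards [eventually_nhdsGT_sub_mem (Ioi_mem_nhds ht0), self_mem_nhdsWithin]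
          with s hs hs0
        have hs0' : 0 < s := hs0
        have hs1 : t - s ∈ Set.Icc 0 τ := ⟨le_of_lt hs, by linarith [ht.2]⟩
        have h2 := Real.log_le_log ((hfl.convex _ (hsub hs1)).pos y) (hmax (t - s) hs1 y)
        simpa using h2)
    have h2 : speed k p φ (h t) y ≤ M * (h t y ^ (1 - p) * h t y ^ k) := by
      have h3 := hct.sigma_le_of_isMax hkn (hmax t ht)
      have hφy := hφpos y
      have h4 := (hmM y).2
      have h5 := hct.sigma_pos hk hkn y
      rw [← mul_assoc, speed]
      gcongr
    have h3 := (hnorm T h hfl t htI y).1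
    have h4 : c₂ * h t y ^ (k + 1) ≤ M * (h t y ^ (1 - p) * h t y ^ k) := by linarith
    rw [← hrpow _ hy] at h4
    have h5 : 0 < h t y ^ (1 - p) * h t y ^ k := by positivity
    have h6 : c₂ * h t y ^ p ≤ M := by
      refine le_of_mul_le_mul_right (Eq.trans_le ?_ h4) h5
      ring
    refine le_trans ?_ (le_max_right _ _)
    rw [Real.le_rpow_inv_iff_of_pos hy.le (by positivity) hp0, le_div_iff₀ hc₂pos]
    linarith

end SphereFlow

theorem mainTheorem5 (n k : ℕ) (hk : 1 ≤ k) (hkn : k ≤ n) (p : ℝ) (hp : (k : ℝ) + 1 ≤ p)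
    (φ : SphereFlow.Sph n → ℝ) (hφ : ContMDiff (𝓡 n) 𝓘(ℝ, ℝ) ∞ φ) (hφpos : ∀ x, 0 < φ x)
    (h₀ : SphereFlow.Sph n → ℝ) (hh₀ : SphereFlow.IsConvexSupport h₀) :
    ∃ γ a b c d : ℝ, 0 < γ ∧ 0 < a ∧ 0 < b ∧ 0 < c ∧ 0 < d ∧
      ∀ (T : EReal) (h : ℝ → SphereFlow.Sph n → ℝ),
        SphereFlow.IsNormalizedFlow k p φ h₀ T h →
        ∀ τ ∈ SphereFlow.timeInterval T, ∀ x : SphereFlow.Sph n,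
          ‖SphereFlow.sphGrad (fun y => Real.log (h τ y)) x‖ ≤ γ ∧
          (a ≤ h τ x ∧ h τ x ≤ b) ∧
          (c ≤ SphereFlow.sigma k (h τ) x ∧ SphereFlow.sigma k (h τ) x ≤ d) := by
  obtain ⟨c, C, hc, hC, hpinch⟩ :=
    SphereFlow.exists_sigma_pinching hk hkn hp hφ.continuous hφpos hh₀
  obtain ⟨a, b, ha, hb, hbounds⟩ :=
    SphereFlow.exists_support_bounds hk hkn hp hφ.continuous hφpos hh₀
  refine ⟨b / a, a, b, c * a ^ k, C * b ^ k, by positivity, ha, hb, by positivity, by positivity,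
    fun T h hfl τ hτ x => ?_⟩
  have hcv := hfl.convex τ hτ
  have hx := hcv.pos x
  obtain ⟨hax, hbx⟩ := hbounds T h hfl τ hτ x
  obtain ⟨h1, h2⟩ := hpinch T h hfl τ hτ x
  refine ⟨?_, ⟨hax, hbx⟩, le_trans (by gcongr) h1, h2.trans (by gcongr)⟩
  have hgrad := SphereFlow.norm_sphGrad_le hcv.smooth hcv.nonneg hb.le
    (fun y => (hbounds T h hfl τ hτ y).2) x
  rw [SphereFlow.sphGrad_log hcv.smooth hcv.pos, norm_smul, norm_inv, Real.norm_of_nonneg hx.le,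
    inv_mul_eq_div]
  gcongr
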